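/- Theorem 3.2. Let $\widetilde M(c)$ be a real space form of dimension $m$, i.e. a Riemannian manifold all of whose sectional curvatures equal the constant $c\in\mathbb R$, and let $M$ be a Riemannian manifold of dimension $n\ge 3$ isometrically immersed in $\widetilde M(c)$ (for example a Riemannian submanifold); all manifolds, metrics and immersions are smooth and without boundary. For $x\in M$ let $\tau(x)=\sum_{1\le i<j\le n}k(e_i\wedge e_j)$ be the scalar curvature, where $k$ denotes the sectional curvature of $M$ and $\{e_1,\dots,e_n\}$ is any orthonormal basis of $T_xM$. Let $\max k(x)$ be the largest sectional curvature of the planes in $T_xM$ (this maximum is attained), and put $\delta'_M(x)=\tau(x)+\max k(x)$. Let $h$ be the second fundamental form and $H=\frac1n\sum_{i=1}^n h(e_i,e_i)$ the mean curvature vector. Then at every point $x\in M$ $$\delta'_M\le \frac{(n^2-n+2)c}{2}+\frac{n^2\|H\|^2}{2}.$$ Equality holds at $x$ if and only if there are an orthonormal basis $\{e_1,\dots,e_n\}$ of $T_xM$ and an orthonormal basis $\{e_{n+1},\dots,e_m\}$ of the normal space $T_x^\perp M$ such that for every $r\in\{n+1,\dots,m\}$ the Weingarten operator $A_r$ in the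 direction $e_r$, given by $\langle A_r u,v\rangle=\langle h(u,v),e_r\rangle$, has in the basis $\{e_1,\dots,e_n\}$ the matrix $$A_r=\operatorname{diag}(h^r_{11},h^r_{22},0,\dots,0)\qquad\text{with } h^r_{11}=h^r_{22}.$$ -/

import Mathlib

set_option maxSynthPendingDepth 3

open scoped ContDiff Manifold

noncomputable section

namespace RiemannianGeometry

section Coordinates

/-! Coordinate formulas for a metric `g` given on a domain of a vector space `E`: `g y u v` is the
inner product of the tangent vectors `u`, `v` at the point `y`. -/

variable {E : Type*} [NormedAddCommGroup E] [NormedSpace ℝ E]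

/-- Christoffel symbols of the first kind, as a trilinear form:
`(u, v, w) ↦ (∂_u g(v, w) + ∂_v g(u, w) - ∂_w g(u, v)) / 2`. -/
def christoffelFirst (g : E → E →L[ℝ] E →L[ℝ] ℝ) (y : E) : E →L[ℝ] E →L[ℝ] E →L[ℝ] ℝ :=
  let dg : E →L[ℝ] E →L[ℝ] E →L[ℝ] ℝ := fderiv ℝ g y
  (1 / 2 : ℝ) • (dg + dg.flip -
    ((ContinuousLinearMap.flipₗᵢ ℝ E E ℝ).toContinuousLinearEquiv :
      (E →L[ℝ] E →L[ℝ] ℝ) →L[ℝ] (E →L[ℝ] E →L[ℝ] ℝ)) ∘L dg.flip)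

theorem christoffelFirst_apply (g : E → E →L[ℝ] E →L[ℝ] ℝ) (y u v w : E) :
    christoffelFirst g y u v w =
      (fderiv ℝ g y u v w + fderiv ℝ g y v u w - fderiv ℝ g y w u v) / 2 := by
  simp [christoffelFirst]
  ring

/-- Christoffel symbols (of the second kind) of the Levi-Civita connection of `g`: `Γ_y(u, v)` is
the vector with `g_y(Γ_y(u, v), w) = christoffelFirst g y u v w` for all `w`, so that
`∇_u v = Γ(u, v)` for constant vector fields `u`, `v`. Here `g_y`, seen as a map from `E` to its
dual, is invertible wherever it is an inner product and `E` is finite-dimensional. -/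
def christoffel (g : E → E →L[ℝ] E →L[ℝ] ℝ) (y : E) : E →L[ℝ] E →L[ℝ] E :=
  (ContinuousLinearMap.compL ℝ E (E →L[ℝ] ℝ) E (g y).inverse) ∘L christoffelFirst g y

/-- The Riemann curvature tensor `R(u, v)w = ∇_u ∇_v w - ∇_v ∇_u w - ∇_[u, v] w` of `g`, computed
with constant vector fields `u`, `v`, `w`. -/
def coordCurvature (g : E → E →L[ℝ] E →L[ℝ] ℝ) (y u v w : E) : E :=
  fderiv ℝ (christoffel g) y u v w - fderiv ℝ (christoffel g) y v u w
    + christoffel g y u (christoffel g y v w) - christoffel g y v (christoffel g y u w)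

/-- The derivative `∇_u (df(v))` along a map `f : E → F` for constant `u`, `v`, where `∇` is the
Levi-Civita connection of a metric `g` on a domain of `F`:
`D²f(u, v) + Γ_{f(y)}(Df(u), Df(v))`. -/
def coordDerivativeAlong {F : Type*} [NormedAddCommGroup F] [NormedSpace ℝ F]
    (g : F → F →L[ℝ] F →L[ℝ] ℝ) (f : E → F) (y : E) : E →L[ℝ] E →L[ℝ] F :=
  fderiv ℝ (fderiv ℝ f) y +
    (christoffel g (f y)).bilinearComp (fderiv ℝ f y) (fderiv ℝ f y)

end Coordinates

open Bundle

section Intrinsic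

/-! Riemannian manifolds without boundary, modelled on a finite-dimensional real vector space `E`.
The tangent space `TangentSpace 𝓘(ℝ, E) x` of Mathlib is the vector space `E`, a tangent vector
at `x` being represented by its coordinates in the preferred chart at `x`, and it carries
the inner product given by the `RiemannianBundle` structure. -/

variable {E : Type*} [NormedAddCommGroup E] [NormedSpace ℝ E] [FiniteDimensional ℝ E]
  {M : Type*} [TopologicalSpace M] [ChartedSpace E M]
  [RiemannianBundle (fun x : M => TangentSpace 𝓘(ℝ, E) x)]

instance (x : M) : FiniteDimensional ℝ (TangentSpace 𝓘(ℝ, E) x) :=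
  inferInstanceAs (FiniteDimensional ℝ E)

variable (E) in
/-- The Riemannian metric read in the preferred chart `φ` at `x`: at the point `y` of the target
of `φ` in `E` it is the bilinear form `g_y(u, v) = ⟨d(φ⁻¹)_y u, d(φ⁻¹)_y v⟩`. -/
def metricInChart (x : M) (y : E) : E →L[ℝ] E →L[ℝ] ℝ :=
  (innerSL ℝ (E := TangentSpace 𝓘(ℝ, E) ((extChartAt 𝓘(ℝ, E) x).symm y))).bilinearComp
    (mfderiv 𝓘(ℝ, E) 𝓘(ℝ, E) (extChartAt 𝓘(ℝ, E) x).symm y)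
    (mfderiv 𝓘(ℝ, E) 𝓘(ℝ, E) (extChartAt 𝓘(ℝ, E) x).symm y)

variable (E) in
/-- The Riemann curvature tensor `(u, v, w) ↦ R(u, v)w` of `M` at `x`, computed in the preferred
chart at `x`, in which the coordinate representation of a vector tangent at `x` is the vector
itself. -/
def curvatureTensor (x : M) (u v w : TangentSpace 𝓘(ℝ, E) x) : TangentSpace 𝓘(ℝ, E) x :=
  coordCurvature (metricInChart E x) (extChartAt 𝓘(ℝ, E) x x) u v w

variable (E) in
/-- The sectional curvature of the plane spanned by two linearly independent tangent vectors. -/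
def sectionalCurvature (x : M) (u v : TangentSpace 𝓘(ℝ, E) x) : ℝ :=
  inner ℝ (curvatureTensor E x u v v) u / (‖u‖ ^ 2 * ‖v‖ ^ 2 - inner ℝ u v ^ 2)

variable (E) in
/-- The set of the sectional curvatures of all planes in the tangent space at `x`; each plane is
given by an orthonormal basis. -/
def sectionalCurvatures (x : M) : Set ℝ :=
  {k | ∃ u v : TangentSpace 𝓘(ℝ, E) x, Orthonormal ℝ ![u, v] ∧ k = sectionalCurvature E x u v}

variable (E) in
/-- The maximum `max k` of the sectional curvature at `x`. -/
def maxSectionalCurvature (x : M) : ℝ := sSup (sectionalCurvatures E x)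

variable (E) in
/-- The scalar curvature `τ = ∑_{i < j} k(e_i ∧ e_j)` at `x`, for an orthonormal basis
`(e_i)` of the tangent space (its value does not depend on the basis). -/
def scalarCurvature (x : M) : ℝ :=
  let e := stdOrthonormalBasis ℝ (TangentSpace 𝓘(ℝ, E) x)
  ∑ i, ∑ j, if i < j then sectionalCurvature E x (e i) (e j) else 0

variable (E) in
/-- The invariant `δ'_M = τ + max k`, as a function on `M`. -/
def deltaPrime (x : M) : ℝ := scalarCurvature E x + maxSectionalCurvature E x

variable (E M) in
/-- All sectional curvatures of `M`, at all points, are equal to `c`. -/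
def HasConstantSectionalCurvature (c : ℝ) : Prop :=
  ∀ (x : M) (u v : TangentSpace 𝓘(ℝ, E) x),
    Orthonormal ℝ ![u, v] → sectionalCurvature E x u v = c

end Intrinsic

section Extrinsic

variable (E : Type*) [NormedAddCommGroup E] [NormedSpace ℝ E] [FiniteDimensional ℝ E]
  {M : Type*} [TopologicalSpace M] [ChartedSpace E M]
  [RiemannianBundle (fun x : M => TangentSpace 𝓘(ℝ, E) x)]
  (F : Type*) [NormedAddCommGroup F] [NormedSpace ℝ F] [FiniteDimensional ℝ F]
  {N : Type*} [TopologicalSpace N] [ChartedSpace F N]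
  [RiemannianBundle (fun x : N => TangentSpace 𝓘(ℝ, F) x)]

/-- Smooth isometric immersions `f : M → N`: smooth maps whose differentials preserve the inner
products (hence are injective). The inclusion of a Riemannian submanifold is one. -/
structure IsIsometricImmersion (f : M → N) : Prop where
  smooth : ContMDiff 𝓘(ℝ, E) 𝓘(ℝ, F) ∞ f
  isometric : ∀ (x : M) (u v : TangentSpace 𝓘(ℝ, E) x),
    inner ℝ (mfderiv 𝓘(ℝ, E) 𝓘(ℝ, F) f x u) (mfderiv 𝓘(ℝ, E) 𝓘(ℝ, F) f x v) = inner ℝ u v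

/-- The normal space at `x`: the orthogonal complement of the image of `df_x`. -/
def normalSpace (f : M → N) (x : M) : Submodule ℝ (TangentSpace 𝓘(ℝ, F) (f x)) :=
  (LinearMap.range (mfderiv 𝓘(ℝ, E) 𝓘(ℝ, F) f x).toLinearMap)ᗮ

/-- The ambient derivative `∇_u (df(v))` along `f` at `x`, where `u`, `v` are extended to vector
fields on `M` that are constant in the preferred chart at `x`, and `∇` is the Levi-Civita
connection of `N`; it is computed in the preferred charts at `x` and at `f x`. -/
def ambientDerivative (f : M → N) (x : M) :
    TangentSpace 𝓘(ℝ, E) x →L[ℝ] TangentSpace 𝓘(ℝ, E) x →L[ℝ] TangentSpace 𝓘(ℝ, F) (f x) :=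
  let B : E →L[ℝ] E →L[ℝ] F :=
    coordDerivativeAlong (metricInChart F (f x)) (writtenInExtChartAt 𝓘(ℝ, E) 𝓘(ℝ, F) x f)
      (extChartAt 𝓘(ℝ, E) x x)
  B

/-- The second fundamental form `h(u, v)`: the normal component of the ambient derivative
`∇_u (df(v))` (Gauss formula). -/
def secondFundamentalForm (f : M → N) (x : M) (u v : TangentSpace 𝓘(ℝ, E) x) :
    normalSpace E F f x :=
  (normalSpace E F f x).orthogonalProjectionOnto (ambientDerivative E F f x u v)

/-- The mean curvature vector `H = (1 / n) ∑_i h(e_i, e_i)`, for an orthonormal basis `(e_i)` of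
the tangent space (its value does not depend on the basis), `n` being the dimension of `M`. -/
def meanCurvature (f : M → N) (x : M) : normalSpace E F f x :=
  let e := stdOrthonormalBasis ℝ (TangentSpace 𝓘(ℝ, E) x)
  (Module.finrank ℝ E : ℝ)⁻¹ • ∑ i, secondFundamentalForm E F f x (e i) (e i)

/-- The linear form `v ↦ ⟨h(u, v), ξ⟩`. -/
def weingartenForm (f : M → N) (x : M) (ξ : normalSpace E F f x) (u : TangentSpace 𝓘(ℝ, E) x) :
    TangentSpace 𝓘(ℝ, E) x →L[ℝ] ℝ :=
  innerSL ℝ ξ ∘L (normalSpace E F f x).orthogonalProjectionOnto ∘L ambientDerivative E F f x u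

/-- The Weingarten (shape) operator `A_ξ` in the normal direction `ξ`: the endomorphism of the
tangent space with `⟨A_ξ u, v⟩ = ⟨h(u, v), ξ⟩` for all `u`, `v`. -/
def weingarten (f : M → N) (x : M) (ξ : normalSpace E F f x) :
    TangentSpace 𝓘(ℝ, E) x →ₗ[ℝ] TangentSpace 𝓘(ℝ, E) x where
  toFun u := (InnerProductSpace.toDual ℝ (TangentSpace 𝓘(ℝ, E) x)).symm (weingartenForm E F f x ξ u)
  map_add' u v := by
    rw [← map_add]
    congr 1
    ext w
    simp [weingartenForm]
  map_smul' a u := by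
    have : weingartenForm E F f x ξ (a • u) = a • weingartenForm E F f x ξ u := by
      ext w
      simp [weingartenForm]
    rw [this]
    simp

theorem inner_weingarten (f : M → N) (x : M) (ξ : normalSpace E F f x)
    (u v : TangentSpace 𝓘(ℝ, E) x) :
    inner ℝ (weingarten E F f x ξ u) v = inner ℝ (secondFundamentalForm E F f x u v) ξ := by
  rw [real_inner_comm ξ]
  exact InnerProductSpace.toDual_symm_apply

end Extrinsic

end RiemannianGeometry

end

/-! In a space form the Gauss equation gives k(u∧v) = c + ⟨h(u,u), h(v,v)⟩ - ‖h(u,v)‖² for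
orthonormal u, v. Summing over i < j in an orthonormal basis yields 2τ = (n² - n)c + n²‖H‖² -
∑‖h(e_k,e_l)‖². Hence, for i ≠ j, τ + k(e_i∧e_j) is the asserted bound minus half of ∑‖h_kl‖² -
2⟨h_ii, h_jj⟩ + 2‖h_ij‖² (`scalarCurvature_add_sectionalCurvature`).

Completing the square (`sum_norm_sq_sub_eq`) turns this defect into ‖h_ii - h_jj‖² + 2‖h_ij‖² plus
the squares of all entries other than h_ii and h_jj. It is nonnegative, and it vanishes exactly when
h_ii = h_jj and every other entry is zero. A basis adapted to a plane of maximal curvature, which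
exists by compactness, gives the inequality and the necessity of the equality condition. Conversely,
if the defect vanishes for some basis, then τ + k(e_i∧e_j) already equals the bound, and max k ≥
k(e_i∧e_j).

The longest part is the Gauss equation itself, proved in charts (`coord_gauss`). The pairing of
∇_v(df w) with df t is a Christoffel symbol of the first kind of the induced metric g.
Differentiating this expresses the ambient curvature through derivatives of these symbols and
products of ambient derivatives. The same formula for the identity map computes the curvature of g,
and in the difference the derivatives of the symbols cancel. -/

set_option linter.unusedSectionVars false

namespace RiemannianGeometry

open Filter Topology Bundle

/-! ### Orthonormal bases and the sum-of-squares form of the defect. -/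

section Algebra

variable {V W : Type*} [NormedAddCommGroup V] [InnerProductSpace ℝ V]
  [NormedAddCommGroup W] [InnerProductSpace ℝ W]
  {ι κ : Type*} [Fintype ι] [Fintype κ]

/-- The trace of a bilinear map does not depend on the orthonormal basis. -/
theorem sum_bilin_orthonormalBasis_eq {W : Type*} [AddCommGroup W] [Module ℝ W]
    (b : V →ₗ[ℝ] V →ₗ[ℝ] W) (e : OrthonormalBasis ι ℝ V) (e' : OrthonormalBasis κ ℝ V) :
    ∑ i, b (e i) (e i) = ∑ j, b (e' j) (e' j) := by
  have h1 : ∀ i, b (e i) (e i) = ∑ j, inner ℝ (e' j) (e i) • b (e' j) (e i) := by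
    intro i
    have h := congrArg (fun t => b t (e i)) (e'.sum_repr' (e i))
    simpa using h.symm
  have h2 : ∀ j, b (e' j) (e' j) = ∑ i, inner ℝ (e' j) (e i) • b (e' j) (e i) := by
    intro j
    have h := congrArg (b (e' j)) (e.sum_repr' (e' j))
    simp_rw [real_inner_comm (e' j)] at h
    simpa using h.symm
  simp_rw [h1, h2]
  exact Finset.sum_comm

theorem sum_norm_sq_orthonormalBasis_eq (L : V →ₗ[ℝ] W) (e : OrthonormalBasis ι ℝ V)
    (e' : OrthonormalBasis κ ℝ V) : ∑ i, ‖L (e i)‖ ^ 2 = ∑ j, ‖L (e' j)‖ ^ 2 := by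
  have h := sum_bilin_orthonormalBasis_eq ((innerₗ W).compl₁₂ L L) e e'
  simpa using h

/-- One index is changed at a time, passing through a sum over both bases. -/
theorem sum_sum_norm_sq_orthonormalBasis_eq (h : V →ₗ[ℝ] V →ₗ[ℝ] W) (e : OrthonormalBasis ι ℝ V)
    (e' : OrthonormalBasis κ ℝ V) :
    ∑ i, ∑ j, ‖h (e i) (e j)‖ ^ 2 = ∑ i, ∑ j, ‖h (e' i) (e' j)‖ ^ 2 := by
  calc ∑ i, ∑ j, ‖h (e i) (e j)‖ ^ 2 = ∑ i, ∑ j, ‖h (e i) (e' j)‖ ^ 2 :=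
        Finset.sum_congr rfl fun i _ => sum_norm_sq_orthonormalBasis_eq (h (e i)) e e'
    _ = ∑ j, ∑ i, ‖h.flip (e' j) (e i)‖ ^ 2 := Finset.sum_comm
    _ = ∑ j, ∑ i, ‖h.flip (e' j) (e' i)‖ ^ 2 :=
        Finset.sum_congr rfl fun j _ => sum_norm_sq_orthonormalBasis_eq (h.flip (e' j)) e e'
    _ = ∑ i, ∑ j, ‖h (e' i) (e' j)‖ ^ 2 := Finset.sum_comm

theorem sum_sum_lt_eq {n : ℕ} (a : Fin n → Fin n → ℝ) (ha : ∀ i j, a i j = a j i) :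
    (∑ i, ∑ j, if i < j then a i j else 0) = (∑ i, ∑ j, a i j - ∑ i, a i i) / 2 := by
  have h1 : ∑ i, ∑ j, a i j = (∑ i, ∑ j, if i < j then a i j else 0)
      + (∑ i, ∑ j, if j < i then a i j else 0) + ∑ i, a i i := by
    rw [← Finset.sum_add_distrib, ← Finset.sum_add_distrib]
    refine Finset.sum_congr rfl fun i _ => ?_
    have : a i i = ∑ j, if i = j then a i j else 0 := by simp
    rw [this, ← Finset.sum_add_distrib, ← Finset.sum_add_distrib]
    refine Finset.sum_congr rfl fun j _ => ?_
    rcases lt_trichotomy i j with hij | hij | hij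
    · simp [hij, hij.not_gt, hij.ne]
    · simp [hij]
    · simp [hij, hij.not_gt, hij.ne']
  have h2 : (∑ i, ∑ j, if j < i then a i j else 0) = ∑ i, ∑ j, if i < j then a i j else 0 := by
    rw [Finset.sum_comm]
    simp_rw [fun i j => ha j i]
  rw [h1, h2]
  ring

/-- The sum over `i < j` of the right-hand sides of the Gauss equation in a space form. -/
theorem sum_sum_lt_gauss {n : ℕ} (c : ℝ) (a : Fin n → Fin n → W) (ha : ∀ i j, a i j = a j i) :
    (∑ i, ∑ j, if i < j then c + inner ℝ (a i i) (a j j) - ‖a i j‖ ^ 2 else 0) =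
      ((n ^ 2 - n) * c + ‖∑ i, a i i‖ ^ 2 - ∑ i, ∑ j, ‖a i j‖ ^ 2) / 2 := by
  rw [sum_sum_lt_eq _ fun i j => by rw [ha i j, real_inner_comm]]
  simp only [real_inner_self_eq_norm_sq, add_sub_cancel_right, Finset.sum_sub_distrib,
    Finset.sum_add_distrib, Finset.sum_const, Finset.card_univ, Fintype.card_fin, nsmul_eq_mul]
  rw [← real_inner_self_eq_norm_sq (∑ i, a i i), sum_inner]
  simp_rw [inner_sum]
  ring

/-- The two diagonal squares at i and j absorb the cross term into ‖a i i - a j j‖²; every other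
square is left alone. -/
theorem sum_norm_sq_sub_eq [DecidableEq ι] (a : ι → ι → W) {i j : ι} (hij : i ≠ j) :
    ∑ k, ∑ l, ‖a k l‖ ^ 2 - 2 * inner ℝ (a i i) (a j j) + 2 * ‖a i j‖ ^ 2 =
      ‖a i i - a j j‖ ^ 2 + 2 * ‖a i j‖ ^ 2 +
        ∑ p ∈ ({(i, i), (j, j)} : Finset (ι × ι))ᶜ, ‖a p.1 p.2‖ ^ 2 := by
  rw [← Fintype.sum_prod_type' (f := fun k l => ‖a k l‖ ^ 2),
    ← Finset.sum_add_sum_compl {(i, i), (j, j)}, Finset.sum_pair (by simp [hij]), norm_sub_sq_real]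
  ring

theorem sum_norm_sq_sub_nonneg (a : ι → ι → W) {i j : ι} (hij : i ≠ j) :
    0 ≤ ∑ k, ∑ l, ‖a k l‖ ^ 2 - 2 * inner ℝ (a i i) (a j j) + 2 * ‖a i j‖ ^ 2 := by
  classical
  rw [sum_norm_sq_sub_eq a hij]
  positivity

/-- A sum of squares vanishes only termwise. The side condition on (k, l) means that it is neither
(i, i) nor (j, j), so it also covers `a i j`. -/
theorem sum_norm_sq_sub_eq_zero_iff (a : ι → ι → W) {i j : ι} (hij : i ≠ j) :
    ∑ k, ∑ l, ‖a k l‖ ^ 2 - 2 * inner ℝ (a i i) (a j j) + 2 * ‖a i j‖ ^ 2 = 0 ↔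
      a i i = a j j ∧ ∀ k l, (k ≠ l ∨ (k ≠ i ∧ k ≠ j)) → a k l = 0 := by
  classical
  rw [sum_norm_sq_sub_eq a hij, add_eq_zero_iff_of_nonneg (by positivity) (by positivity),
    add_eq_zero_iff_of_nonneg (by positivity) (by positivity),
    Finset.sum_eq_zero_iff_of_nonneg fun _ _ => by positivity]
  simp only [ne_eq, OfNat.ofNat_ne_zero, not_false_eq_true, pow_eq_zero_iff, norm_eq_zero,
    sub_eq_zero, mul_eq_zero, false_or, Finset.mem_compl, Finset.mem_insert, Finset.mem_singleton,
    Prod.forall, Prod.mk.injEq]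
  constructor
  · rintro ⟨⟨h1, -⟩, h2⟩
    exact ⟨h1, fun k l hkl => h2 k l (by grind)⟩
  · rintro ⟨h1, h2⟩
    exact ⟨⟨h1, h2 i j (.inl hij)⟩, fun k l hkl => h2 k l (by grind)⟩

theorem orthonormal_pair_iff {u v : V} :
    Orthonormal ℝ ![u, v] ↔ ‖u‖ = 1 ∧ ‖v‖ = 1 ∧ inner ℝ u v = 0 := by
  constructor
  · intro h
    exact ⟨h.1 0, h.1 1, h.2 (i := 0) (j := 1) (by simp)⟩
  · rintro ⟨hu, hv, huv⟩
    refine ⟨fun i => ?_, fun i j hij => ?_⟩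
    · fin_cases i
      · exact hu
      · exact hv
    · fin_cases i <;> fin_cases j
      · exact absurd rfl hij
      · exact huv
      · exact (real_inner_comm _ _).trans huv
      · exact absurd rfl hij

theorem exists_orthonormalBasis_extending_pair [FiniteDimensional ℝ V]
    (hcard : Module.finrank ℝ V = Fintype.card ι) {i j : ι} (hij : i ≠ j) {u v : V}
    (huv : Orthonormal ℝ ![u, v]) : ∃ e : OrthonormalBasis ι ℝ V, e i = u ∧ e j = v := by
  classical
  obtain ⟨hu, hv, h0⟩ := orthonormal_pair_iff.1 huv
  -- Only the values at i and j matter: the extension theorem asks for orthonormality of the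
  -- restriction to {i, j}.
  let w : ι → V := fun k => if k = i then u else v
  have hwi : w i = u := by simp [w]
  have hwj : w j = v := by simp [w, hij.symm]
  have hw : Orthonormal ℝ (({i, j} : Set ι).domRestrict w) := by
    refine ⟨?_, ?_⟩
    · rintro ⟨k, rfl | rfl⟩
      · simpa [Set.domRestrict, hwi] using hu
      · simpa [Set.domRestrict, hwj] using hv
    · rintro ⟨k, rfl | rfl⟩ ⟨l, rfl | rfl⟩ hkl
      · exact absurd rfl hkl
      · simpa [Set.domRestrict, hwi, hwj] using h0
      · simpa [Set.domRestrict, hwi, hwj, real_inner_comm] using h0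
      · exact absurd rfl hkl
  obtain ⟨e, he⟩ := hw.exists_orthonormalBasis_extension_of_card_eq hcard
  exact ⟨e, (he i (by simp)).trans hwi, (he j (by simp)).trans hwj⟩

/-- The defining equations are closed and confine the pair to a product of unit spheres. -/
theorem isCompact_orthonormal_pairs [FiniteDimensional ℝ V] :
    IsCompact {p : V × V | Orthonormal ℝ ![p.1, p.2]} := by
  have : ProperSpace V := FiniteDimensional.proper ℝ V
  have h : IsCompact (Metric.sphere (0 : V) 1 ×ˢ Metric.sphere (0 : V) 1) :=
    (isCompact_sphere _ _).prod (isCompact_sphere _ _)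
  refine (h.inter_right (t := {p : V × V | inner ℝ p.1 p.2 = 0})
    (isClosed_eq (by fun_prop) (by fun_prop))).of_isClosed_subset ?_ ?_
  · simp_rw [orthonormal_pair_iff]
    exact (isClosed_eq (by fun_prop) (by fun_prop)).inter ((isClosed_eq (by fun_prop)
      (by fun_prop)).inter (isClosed_eq (by fun_prop) (by fun_prop)))
  · rintro ⟨u, v⟩ huv
    obtain ⟨hu, hv, h0⟩ := orthonormal_pair_iff.1 huv
    exact ⟨⟨by simpa using hu, by simpa using hv⟩, h0⟩

end Algebra

/-! ### The Levi-Civita connection and the Gauss equation in coordinates. -/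

section CoordinateGauss

variable {E F : Type*} [NormedAddCommGroup E] [NormedSpace ℝ E]
  [NormedAddCommGroup F] [NormedSpace ℝ F]
  {G : F → F →L[ℝ] F →L[ℝ] ℝ} {g : E → E →L[ℝ] E →L[ℝ] ℝ} {f : E → F} {p : F} {y : E}

theorem metric_christoffel (hinv : (G p).IsInvertible) (u v w : F) :
    G p (christoffel G p u v) w = christoffelFirst G p u v w := by
  change G p ((G p).inverse (christoffelFirst G p u v)) w = _
  rw [hinv.self_apply_inverse]

theorem fderiv_metric_symm (hG : DifferentiableAt ℝ G p)
    (hsymm : ∀ᶠ q in 𝓝 p, ∀ u v, G q u v = G q v u) (a u v : F) :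
    fderiv ℝ G p a u v = fderiv ℝ G p a v u := by
  have key : ∀ u v, fderiv ℝ (fun q => G q u v) p a = fderiv ℝ G p a u v := by
    intro u v
    have h := (hG.hasFDerivAt.clm_apply (hasFDerivAt_const u p)).clm_apply (hasFDerivAt_const v p)
    rw [h.fderiv]
    simp
  rw [← key, ← key]
  congr 1
  apply EventuallyEq.fderiv_eq
  filter_upwards [hsymm] with q hq using hq u v

theorem christoffelFirst_symm (hG : DifferentiableAt ℝ G p)
    (hsymm : ∀ᶠ q in 𝓝 p, ∀ u v, G q u v = G q v u) (u v w : F) :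
    christoffelFirst G p u v w = christoffelFirst G p v u w := by
  rw [christoffelFirst_apply, christoffelFirst_apply, fderiv_metric_symm hG hsymm w u v]
  ring

/-- Torsion-freeness of the Levi-Civita connection, inherited from the symbols of the first kind. -/
theorem christoffel_symm (hG : DifferentiableAt ℝ G p)
    (hsymm : ∀ᶠ q in 𝓝 p, ∀ u v, G q u v = G q v u) (u v : F) :
    christoffel G p u v = christoffel G p v u := by
  change (G p).inverse (christoffelFirst G p u v) = (G p).inverse (christoffelFirst G p v u)
  congr 1
  ext w
  exact christoffelFirst_symm hG hsymm u v w

/-- The Levi-Civita connection is compatible with the metric. -/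
theorem fderiv_metric_eq (hG : DifferentiableAt ℝ G p)
    (hsymm : ∀ᶠ q in 𝓝 p, ∀ u v, G q u v = G q v u) (hinv : (G p).IsInvertible) (a u v : F) :
    fderiv ℝ G p a u v = G p (christoffel G p a u) v + G p u (christoffel G p a v) := by
  rw [hsymm.self_of_nhds u, metric_christoffel hinv, metric_christoffel hinv,
    christoffelFirst_apply, christoffelFirst_apply, fderiv_metric_symm hG hsymm a v u]
  ring

theorem contDiffAt_christoffelFirst {n : ℕ∞ω} (hG : ContDiffAt ℝ (n + 1) G p) :
    ContDiffAt ℝ n (christoffelFirst G) p := by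
  have h := hG.fderiv_right le_rfl
  have hflip : ContDiffAt ℝ n (fun q => (fderiv ℝ G q).flip) p :=
    ((ContinuousLinearMap.flipₗᵢ ℝ F F (F →L[ℝ] ℝ)).contDiff.contDiffAt).comp p h
  have h3 : ContDiffAt ℝ n (fun q =>
      ((ContinuousLinearMap.flipₗᵢ ℝ F F ℝ).toContinuousLinearEquiv :
        (F →L[ℝ] F →L[ℝ] ℝ) →L[ℝ] (F →L[ℝ] F →L[ℝ] ℝ)) ∘L (fderiv ℝ G q).flip) p :=
    contDiffAt_const.clm_comp hflip
  exact ((h.add hflip).sub h3).const_smul (1 / 2 : ℝ)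

theorem contDiffAt_christoffel [CompleteSpace F] {n : ℕ∞ω} (hG : ContDiffAt ℝ (n + 1) G p)
    (hinv : (G p).IsInvertible) : ContDiffAt ℝ n (christoffel G) p := by
  have h := contDiffAt_christoffelFirst hG
  have hi : ContDiffAt ℝ n (fun q => (G q).inverse) p :=
    (hinv.contDiffAt_map_inverse).comp p (hG.of_le le_self_add)
  exact ((ContinuousLinearMap.compL ℝ F (F →L[ℝ] ℝ) F).contDiff.contDiffAt.comp p hi).clm_comp h

theorem fderiv_metric_along (hG : DifferentiableAt ℝ G (f y)) (hf : DifferentiableAt ℝ f y)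
    {X Y : E → F} (hX : DifferentiableAt ℝ X y) (hY : DifferentiableAt ℝ Y y) (u : E) :
    fderiv ℝ (fun y => G (f y) (X y) (Y y)) y u =
      fderiv ℝ G (f y) (fderiv ℝ f y u) (X y) (Y y) + G (f y) (fderiv ℝ X y u) (Y y)
        + G (f y) (X y) (fderiv ℝ Y y u) := by
  have h := ((hG.hasFDerivAt.comp y hf.hasFDerivAt).clm_apply hX.hasFDerivAt).clm_apply
    hY.hasFDerivAt
  have h2 := h.fderiv
  simp only [Function.comp_def] at h2
  rw [h2]
  simp
  ring

/-- Differentiation of an inner product of vector fields along a map. -/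
theorem fderiv_metric_along_eq (hG : DifferentiableAt ℝ G (f y))
    (hsymm : ∀ᶠ q in 𝓝 (f y), ∀ u v, G q u v = G q v u) (hinv : (G (f y)).IsInvertible)
    (hf : DifferentiableAt ℝ f y)
    {X Y : E → F} (hX : DifferentiableAt ℝ X y) (hY : DifferentiableAt ℝ Y y) (u : E) :
    fderiv ℝ (fun y => G (f y) (X y) (Y y)) y u =
      G (f y) (fderiv ℝ X y u + christoffel G (f y) (fderiv ℝ f y u) (X y)) (Y y)
        + G (f y) (X y) (fderiv ℝ Y y u + christoffel G (f y) (fderiv ℝ f y u) (Y y)) := by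
  rw [fderiv_metric_along hG hf hX hY, fderiv_metric_eq hG hsymm hinv]
  simp only [map_add, add_apply]
  ring

theorem coordDerivativeAlong_apply (u v : E) : coordDerivativeAlong G f y u v =
    fderiv ℝ (fderiv ℝ f) y u v + christoffel G (f y) (fderiv ℝ f y u) (fderiv ℝ f y v) := by
  simp [coordDerivativeAlong]

theorem fderiv_fderiv_symm (hf : ContDiffAt ℝ 2 f y) (u v : E) :
    fderiv ℝ (fderiv ℝ f) y u v = fderiv ℝ (fderiv ℝ f) y v u :=
  (hf.isSymmSndFDerivAt (by simp)) u v

theorem coordDerivativeAlong_symm (hf : ContDiffAt ℝ 2 f y) (hG : DifferentiableAt ℝ G (f y))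
    (hsymm : ∀ᶠ q in 𝓝 (f y), ∀ u v, G q u v = G q v u) (u v : E) :
    coordDerivativeAlong G f y u v = coordDerivativeAlong G f y v u := by
  rw [coordDerivativeAlong_apply, coordDerivativeAlong_apply, fderiv_fderiv_symm hf,
    christoffel_symm hG hsymm]

/-- The tangential component of the derivative along `f` is given by the Christoffel symbols of
the induced metric. -/
theorem metric_coordDerivativeAlong (hf : ContDiffAt ℝ 2 f y) (hG : DifferentiableAt ℝ G (f y))
    (hsymm : ∀ᶠ q in 𝓝 (f y), ∀ u v, G q u v = G q v u) (hinv : (G (f y)).IsInvertible)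
    (hgd : DifferentiableAt ℝ g y)
    (hg : ∀ᶠ z in 𝓝 y, ∀ u v, g z u v = G (f z) (fderiv ℝ f z u) (fderiv ℝ f z v)) (u v w : E) :
    G (f y) (coordDerivativeAlong G f y u v) (fderiv ℝ f y w) = christoffelFirst g y u v w := by
  have hdf : DifferentiableAt ℝ (fderiv ℝ f) y :=
    (hf.fderiv_right (m := 1) (by norm_num)).differentiableAt (by norm_num)
  have happ : ∀ v u, fderiv ℝ (fun z => fderiv ℝ f z v) y u = fderiv ℝ (fderiv ℝ f) y u v := by
    intro v u
    rw [(hdf.hasFDerivAt.clm_apply (hasFDerivAt_const v y)).fderiv]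
    simp
  have key : ∀ a u v, fderiv ℝ g y a u v =
      fderiv ℝ G (f y) (fderiv ℝ f y a) (fderiv ℝ f y u) (fderiv ℝ f y v)
      + G (f y) (fderiv ℝ (fderiv ℝ f) y a u) (fderiv ℝ f y v)
      + G (f y) (fderiv ℝ f y u) (fderiv ℝ (fderiv ℝ f) y a v) := by
    intro a u v
    have h := (hgd.hasFDerivAt.clm_apply (hasFDerivAt_const u y)).clm_apply (hasFDerivAt_const v y)
    have h1 : fderiv ℝ (fun z => g z u v) y a = fderiv ℝ g y a u v := by
      rw [h.fderiv]; simp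
    rw [← h1, EventuallyEq.fderiv_eq (hg.mono fun z hz => hz u v),
      fderiv_metric_along hG (hf.differentiableAt (by norm_num))
        (hdf.clm_apply (differentiableAt_const _)) (hdf.clm_apply (differentiableAt_const _)),
      happ, happ]
  -- In the Koszul combination of the three instances of `key`, symmetry of D²f cancels all
  -- second-derivative terms except 2 G(D²f(u, v), df w).
  rw [coordDerivativeAlong_apply, map_add, add_apply,
    metric_christoffel hinv, christoffelFirst_apply, christoffelFirst_apply, key, key, key,
    fderiv_fderiv_symm hf w u, fderiv_fderiv_symm hf v u, fderiv_fderiv_symm hf w v,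
    hsymm.self_of_nhds (fderiv ℝ f y v), hsymm.self_of_nhds (fderiv ℝ f y u)]
  ring

/-- The curvature of the pulled back connection is the pullback of the curvature. -/
theorem coordCurvature_along [CompleteSpace F] (hf : ContDiffAt ℝ 3 f y)
    (hG : ContDiffAt ℝ 2 G (f y))
    (hinv : (G (f y)).IsInvertible) (u v w : E) :
    coordCurvature G (f y) (fderiv ℝ f y u) (fderiv ℝ f y v) (fderiv ℝ f y w) =
      (fderiv ℝ (fun z => coordDerivativeAlong G f z v w) y u
        + christoffel G (f y) (fderiv ℝ f y u) (coordDerivativeAlong G f y v w))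
      - (fderiv ℝ (fun z => coordDerivativeAlong G f z u w) y v
        + christoffel G (f y) (fderiv ℝ f y v) (coordDerivativeAlong G f y u w)) := by
  have hΓ : DifferentiableAt ℝ (christoffel G) (f y) :=
    (contDiffAt_christoffel (n := 1) (by simpa [one_add_one_eq_two] using hG) hinv).differentiableAt
      (by norm_num)
  have hfd : DifferentiableAt ℝ f y := hf.differentiableAt (by norm_num)
  have hdf2 : ContDiffAt ℝ 2 (fderiv ℝ f) y := hf.fderiv_right (by norm_num)
  have hdf : DifferentiableAt ℝ (fderiv ℝ f) y := hdf2.differentiableAt (by norm_num)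
  have hddf : DifferentiableAt ℝ (fderiv ℝ (fderiv ℝ f)) y :=
    (hdf2.fderiv_right (m := 1) (by norm_num)).differentiableAt (by norm_num)
  have key : ∀ u v w, fderiv ℝ (fun z => coordDerivativeAlong G f z v w) y u =
      fderiv ℝ (fderiv ℝ (fderiv ℝ f)) y u v w
      + fderiv ℝ (christoffel G) (f y) (fderiv ℝ f y u) (fderiv ℝ f y v) (fderiv ℝ f y w)
      + christoffel G (f y) (fderiv ℝ (fderiv ℝ f) y u v) (fderiv ℝ f y w)
      + christoffel G (f y) (fderiv ℝ f y v) (fderiv ℝ (fderiv ℝ f) y u w) := by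
    intro u v w
    have hc : ∀ v, HasFDerivAt (fun z => fderiv ℝ f z v) _ y := fun v =>
      hdf.hasFDerivAt.clm_apply (hasFDerivAt_const v y)
    have h := (((hddf.hasFDerivAt.clm_apply (hasFDerivAt_const v y)).clm_apply
      (hasFDerivAt_const w y))).add
      (((hΓ.hasFDerivAt.comp y hfd.hasFDerivAt).clm_apply (hc v)).clm_apply (hc w))
    have e : (fun z => coordDerivativeAlong G f z v w) = (fun z => fderiv ℝ (fderiv ℝ f) z v w) +
        fun z => (christoffel G ∘ f) z (fderiv ℝ f z v) (fderiv ℝ f z w) := by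
      funext z
      simp [coordDerivativeAlong_apply]
    rw [e, h.fderiv]
    simp
    abel
  -- The third derivatives of f must cancel on antisymmetrizing in u and v; this is symmetry of the
  -- second derivative of Df.
  have h3 : fderiv ℝ (fderiv ℝ (fderiv ℝ f)) y u v w = fderiv ℝ (fderiv ℝ (fderiv ℝ f)) y v u w := by
    rw [fderiv_fderiv_symm hdf2]
  have hGd : DifferentiableAt ℝ G (f y) := hG.differentiableAt (by norm_num)
  rw [key, key, h3, coordDerivativeAlong_apply, coordDerivativeAlong_apply, coordCurvature,
    fderiv_fderiv_symm (hf.of_le (by norm_num)) v u]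
  simp only [map_add]
  abel

/-- Metric compatibility moves ∇_u off ∇_v(df w): its pairing with df t is the derivative of a
first-kind symbol of g minus a product of two ambient derivatives. The differentiated terms depend
only on g, not on the immersion inducing it. -/
theorem metric_coordCurvature_along [CompleteSpace F] (hf : ContDiffAt ℝ 3 f y)
    (hG : ContDiffAt ℝ 2 G (f y))
    (hsymm : ∀ᶠ q in 𝓝 (f y), ∀ u v, G q u v = G q v u)
    (hinv : ∀ᶠ q in 𝓝 (f y), (G q).IsInvertible) (hgd : ContDiffAt ℝ 1 g y)
    (hg : ∀ᶠ z in 𝓝 y, ∀ u v, g z u v = G (f z) (fderiv ℝ f z u) (fderiv ℝ f z v))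
    (u v w t : E) :
    G (f y) (coordCurvature G (f y) (fderiv ℝ f y u) (fderiv ℝ f y v) (fderiv ℝ f y w))
        (fderiv ℝ f y t) =
      fderiv ℝ (fun z => christoffelFirst g z v w t) y u
      - G (f y) (coordDerivativeAlong G f y v w) (coordDerivativeAlong G f y u t)
      - (fderiv ℝ (fun z => christoffelFirst g z u w t) y v
        - G (f y) (coordDerivativeAlong G f y u w) (coordDerivativeAlong G f y v t)) := by
  have hfd : DifferentiableAt ℝ f y := hf.differentiableAt (by norm_num)
  have hdf2 : ContDiffAt ℝ 2 (fderiv ℝ f) y := hf.fderiv_right (by norm_num)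
  have hdf : DifferentiableAt ℝ (fderiv ℝ f) y := hdf2.differentiableAt (by norm_num)
  have hGd : DifferentiableAt ℝ G (f y) := hG.differentiableAt (by norm_num)
  have hΓ : DifferentiableAt ℝ (christoffel G) (f y) :=
    (contDiffAt_christoffel (n := 1) (by simpa [one_add_one_eq_two] using hG)
      hinv.self_of_nhds).differentiableAt (by norm_num)
  have hddf : DifferentiableAt ℝ (fderiv ℝ (fderiv ℝ f)) y :=
    (hdf2.fderiv_right (m := 1) (by norm_num)).differentiableAt (by norm_num)
  have hB : ∀ v w, DifferentiableAt ℝ (fun z => coordDerivativeAlong G f z v w) y := by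
    intro v w
    simp only [coordDerivativeAlong_apply]
    exact ((hddf.clm_apply (differentiableAt_const _)).clm_apply (differentiableAt_const _)).add
      (((hΓ.comp y hfd).clm_apply (hdf.clm_apply (differentiableAt_const _))).clm_apply
        (hdf.clm_apply (differentiableAt_const _)))
  have key : ∀ u v w t, G (f y) (fderiv ℝ (fun z => coordDerivativeAlong G f z v w) y u
        + christoffel G (f y) (fderiv ℝ f y u) (coordDerivativeAlong G f y v w)) (fderiv ℝ f y t)
      = fderiv ℝ (fun z => christoffelFirst g z v w t) y u
      - G (f y) (coordDerivativeAlong G f y v w) (coordDerivativeAlong G f y u t) := by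
    intro u v w t
    have h1 := fderiv_metric_along_eq hGd hsymm hinv.self_of_nhds hfd (hB v w)
      (hdf.clm_apply (differentiableAt_const t)) u
    have h2 : fderiv ℝ (fun z => fderiv ℝ f z t) y u = fderiv ℝ (fderiv ℝ f) y u t := by
      rw [(hdf.hasFDerivAt.clm_apply (hasFDerivAt_const t y)).fderiv]
      simp
    rw [h2, ← coordDerivativeAlong_apply] at h1
    rw [eq_sub_iff_add_eq, ← h1]
    congr 1
    -- Both sides are differentiated, so the tangential formula is needed on a neighbourhood of y
    -- and every hypothesis is propagated there.
    apply EventuallyEq.fderiv_eq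
    filter_upwards [hf.eventually (by simp), hfd.continuousAt.eventually
      (hG.eventually (by simp)), hfd.continuousAt.eventually hsymm.eventually_nhds,
      hfd.continuousAt.eventually hinv, hgd.eventually (by simp), hg.eventually_nhds] with
      z z1 z2 z3 z4 z5 z6
    exact metric_coordDerivativeAlong (z1.of_le (by norm_num)) (z2.differentiableAt (by norm_num))
      z3 z4 (z5.differentiableAt (by norm_num)) z6 v w t
  rw [coordCurvature_along hf hG hinv.self_of_nhds, map_sub, sub_apply,
    key, key]

/-- The Gauss equation in coordinates, for an isometric immersion `f` from `g` to `G`. Inner products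
of normal components are written as differences of inner products of `∇_u (df(v))` and of its
tangential part `df(Γ(u, v))`. -/
theorem coord_gauss [CompleteSpace E] [CompleteSpace F] (hf : ContDiffAt ℝ 3 f y)
    (hG : ContDiffAt ℝ 2 G (f y))
    (hGsymm : ∀ᶠ q in 𝓝 (f y), ∀ u v, G q u v = G q v u)
    (hGinv : ∀ᶠ q in 𝓝 (f y), (G q).IsInvertible) (hgd : ContDiffAt ℝ 2 g y)
    (hgsymm : ∀ᶠ q in 𝓝 y, ∀ u v, g q u v = g q v u)
    (hginv : ∀ᶠ q in 𝓝 y, (g q).IsInvertible)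
    (hg : ∀ᶠ z in 𝓝 y, ∀ u v, g z u v = G (f z) (fderiv ℝ f z u) (fderiv ℝ f z v))
    (u v w t : E) :
    g y (coordCurvature g y u v w) t =
      G (f y) (coordCurvature G (f y) (fderiv ℝ f y u) (fderiv ℝ f y v) (fderiv ℝ f y w))
        (fderiv ℝ f y t)
      + (G (f y) (coordDerivativeAlong G f y v w) (coordDerivativeAlong G f y u t)
        - g y (christoffel g y v w) (christoffel g y u t))
      - (G (f y) (coordDerivativeAlong G f y u w) (coordDerivativeAlong G f y v t)
        - g y (christoffel g y u w) (christoffel g y v t)) := by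
  have h1 := metric_coordCurvature_along hf hG hGsymm hGinv (hgd.of_le (by norm_num)) hg u v w t
  -- The identity is an isometric immersion of g into itself, and its derivative along itself is Γ,
  -- so the same lemma computes the intrinsic curvature.
  have h2 := metric_coordCurvature_along (f := id) (y := y) contDiffAt_id hgd hgsymm hginv
    (hgd.of_le (by norm_num)) (.of_forall fun z u v => by simp) u v w t
  have h3 : ∀ u v, coordDerivativeAlong g id y u v = christoffel g y u v := by
    intro u v
    have : fderiv ℝ (id : E → E) = fun _ => ContinuousLinearMap.id ℝ E := by
      funext z; exact fderiv_id
    rw [coordDerivativeAlong_apply, this]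
    simp
  simp only [h3, fderiv_id, id, ContinuousLinearMap.id_apply] at h2
  rw [h1, h2]
  ring

/-- Naturality of the curvature tensor under linear changes of coordinates. -/
theorem map_coordCurvature [CompleteSpace E] [CompleteSpace F] (e : E ≃L[ℝ] F)
    (hG : ContDiffAt ℝ 2 G (e y)) (hGsymm : ∀ᶠ q in 𝓝 (e y), ∀ u v, G q u v = G q v u)
    (hGinv : ∀ᶠ q in 𝓝 (e y), (G q).IsInvertible)
    (hg : g = fun z => (G (e z)).bilinearComp (e : E →L[ℝ] F) (e : E →L[ℝ] F)) (u v w : E) :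
    e (coordCurvature g y u v w) = coordCurvature G (e y) (e u) (e v) (e w) := by
  have he : ContinuousAt e y := e.continuous.continuousAt
  have hgapp : ∀ z u v, g z u v = G (e z) (e u) (e v) := fun z u v => by rw [hg]; rfl
  have hgcomp : ∀ z, g z = (ContinuousLinearMap.compL ℝ E F ℝ).flip (e : E →L[ℝ] F) ∘L
      (G (e z)) ∘L (e : E →L[ℝ] F) := by
    intro z
    ext u v
    rw [hgapp]
    rfl
  have hgd : ContDiffAt ℝ 2 g y := by
    rw [funext hgcomp]
    exact contDiffAt_const.clm_comp ((hG.comp y e.contDiff.contDiffAt).clm_comp contDiffAt_const)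
  have hgsymm : ∀ᶠ q in 𝓝 y, ∀ u v, g q u v = g q v u := by
    filter_upwards [he.eventually hGsymm] with q hq u v
    rw [hgapp, hgapp, hq]
  have hginv : ∀ᶠ q in 𝓝 y, (g q).IsInvertible := by
    filter_upwards [he.eventually hGinv] with q hq
    obtain ⟨A, hA⟩ := hq
    refine ⟨(e.trans A).trans (e.symm.arrowCongr (ContinuousLinearEquiv.refl ℝ ℝ)), ?_⟩
    ext u v
    rw [hgapp, ← hA]
    simp
  have hpull : ∀ᶠ z in 𝓝 y, ∀ u v, g z u v = G (e z) (fderiv ℝ e z u) (fderiv ℝ e z v) :=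
    .of_forall fun z u v => by rw [e.fderiv]; exact hgapp z u v
  have hnondeg : ∀ a b : F, (∀ t : E, G (e y) a (e t) = G (e y) b (e t)) → a = b := by
    intro a b hab
    apply hGinv.self_of_nhds.injective
    ext t
    simpa using hab (e.symm t)
  -- A linear isometric isomorphism is totally geodesic, so both correction brackets of
  -- `coord_gauss` vanish.
  have hB : ∀ u v, coordDerivativeAlong G e y u v = e (christoffel g y u v) := by
    intro u v
    apply hnondeg
    intro t
    have h := metric_coordDerivativeAlong (f := e) e.contDiff.contDiffAt
      (hG.differentiableAt (by norm_num)) hGsymm hGinv.self_of_nhds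
      (hgd.differentiableAt (by norm_num)) hpull u v t
    rw [← metric_christoffel hginv.self_of_nhds, hgapp, e.fderiv] at h
    exact h
  apply hnondeg
  intro t
  have h := coord_gauss (f := e) e.contDiff.contDiffAt hG hGsymm hGinv hgd hgsymm hginv hpull u v w t
  rw [hB, hB, hB, hB, hgapp, hgapp, hgapp, e.fderiv, sub_self, sub_self, add_zero, sub_zero] at h
  exact h

end CoordinateGauss

/-! ### The metric in a chart: symmetry, invertibility, smoothness. -/

section MetricInChart

variable {E : Type*} [NormedAddCommGroup E] [NormedSpace ℝ E] [FiniteDimensional ℝ E]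
  {M : Type*} [TopologicalSpace M] [ChartedSpace E M]
  [RiemannianBundle (fun x : M => TangentSpace 𝓘(ℝ, E) x)]

variable (E) in
/-- The inner product of the tangent space at `x`, on the model vector space. -/
noncomputable def modelInner (x : M) (u v : E) : ℝ :=
  inner ℝ (show TangentSpace 𝓘(ℝ, E) x from u) (show TangentSpace 𝓘(ℝ, E) x from v)

theorem metricInChart_apply (x : M) (y u v : E) : metricInChart E x y u v =
    modelInner E ((extChartAt 𝓘(ℝ, E) x).symm y)
      (mfderiv 𝓘(ℝ, E) 𝓘(ℝ, E) (extChartAt 𝓘(ℝ, E) x).symm y u)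
      (mfderiv 𝓘(ℝ, E) 𝓘(ℝ, E) (extChartAt 𝓘(ℝ, E) x).symm y v) := rfl

theorem metricInChart_symm (x : M) (y u v : E) :
    metricInChart E x y u v = metricInChart E x y v u :=
  real_inner_comm (F := TangentSpace 𝓘(ℝ, E) ((extChartAt 𝓘(ℝ, E) x).symm y)) _ _

/-- Tangent vectors at x are represented in the preferred chart, so the inverse chart has identity
differential at the base point. -/
theorem metricInChart_self [IsManifold 𝓘(ℝ, E) ∞ M] (x : M) (u v : E) :
    metricInChart E x (extChartAt 𝓘(ℝ, E) x x) u v = modelInner E x u v := by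
  have : IsManifold 𝓘(ℝ, E) 1 M := IsManifold.of_le (n := ∞) (by simp)
  have h := mfderivWithin_range_extChartAt_symm (I := 𝓘(ℝ, E)) (x := x)
  rw [modelWithCornersSelf_coe, Set.range_id, mfderivWithin_univ] at h
  rw [metricInChart_apply, h, extChartAt_to_inv]
  rfl

theorem mfderiv_extChartAt_symm_injective [IsManifold 𝓘(ℝ, E) ∞ M] (x : M) {y : E}
    (hy : y ∈ (extChartAt 𝓘(ℝ, E) x).target) {u : E}
    (hu : mfderiv 𝓘(ℝ, E) 𝓘(ℝ, E) (extChartAt 𝓘(ℝ, E) x).symm y u = 0) : u = 0 := by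
  have : IsManifold 𝓘(ℝ, E) 1 M := IsManifold.of_le (n := ∞) (by simp)
  have h := isInvertible_mfderivWithin_extChartAt_symm (I := 𝓘(ℝ, E)) hy
  rw [modelWithCornersSelf_coe, Set.range_id, mfderivWithin_univ] at h
  exact h.injective (hu.trans (map_zero _).symm)

/-- Positive definiteness makes the map to the dual injective, and the dimensions agree. -/
theorem metricInChart_isInvertible [IsManifold 𝓘(ℝ, E) ∞ M] (x : M) {y : E}
    (hy : y ∈ (extChartAt 𝓘(ℝ, E) x).target) : (metricInChart E x y).IsInvertible := by
  have hinj : Function.Injective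
      (LinearMap.toContinuousLinearMap.symm.toLinearMap ∘ₗ (metricInChart E x y).toLinearMap :
        E →ₗ[ℝ] Module.Dual ℝ E) := by
    rw [injective_iff_map_eq_zero]
    intro u hu
    have h0 : metricInChart E x y u u = 0 := LinearMap.congr_fun hu u
    exact mfderiv_extChartAt_symm_injective x hy (inner_self_eq_zero.1 h0)
  let e := LinearEquiv.ofInjectiveOfFinrankEq _ hinj Subspace.dual_finrank_eq.symm
  refine ⟨(e.trans LinearMap.toContinuousLinearMap).toContinuousLinearEquiv, ?_⟩
  ext u v
  rfl

/-- Constant fields pushed forward by the inverse chart are smooth along it, so smoothness of the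
bundle metric applies to each coefficient; in finite dimension the coefficients suffice. -/
theorem contDiffOn_metricInChart [IsManifold 𝓘(ℝ, E) ∞ M]
    [IsContMDiffRiemannianBundle 𝓘(ℝ, E) ∞ E (fun x : M => TangentSpace 𝓘(ℝ, E) x)] (x : M) :
    ContDiffOn ℝ ∞ (metricInChart E x) (extChartAt 𝓘(ℝ, E) x).target := by
  have hopen := isOpen_extChartAt_target (I := 𝓘(ℝ, E)) x
  have htan := (contMDiffOn_extChartAt_symm (I := 𝓘(ℝ, E)) (n := ∞) x).contMDiffOn_tangentMapWithin
    (m := ∞) (by simp) hopen.uniqueMDiffOn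
  have hsec : ∀ u : E, ContMDiffOn 𝓘(ℝ, E) 𝓘(ℝ, E).tangent ∞
      (fun y => (⟨(extChartAt 𝓘(ℝ, E) x).symm y,
        mfderiv 𝓘(ℝ, E) 𝓘(ℝ, E) (extChartAt 𝓘(ℝ, E) x).symm y u⟩ : TangentBundle 𝓘(ℝ, E) M))
      (extChartAt 𝓘(ℝ, E) x).target := by
    intro u
    have hc : ContMDiffOn 𝓘(ℝ, E) 𝓘(ℝ, E).tangent ∞
        (fun y : E => (⟨y, u⟩ : TangentBundle 𝓘(ℝ, E) E)) (extChartAt 𝓘(ℝ, E) x).target := by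
      intro y _
      apply ContMDiffAt.contMDiffWithinAt
      exact (contMDiffAt_vectorSpace_iff_contDiffAt (V := fun _ : E => u)).2 contDiffAt_const
    refine (htan.comp hc fun y hy => hy).congr fun y hy => ?_
    simp only [tangentMapWithin, Function.comp]
    rw [mfderivWithin_of_isOpen hopen hy]
  rw [contDiffOn_clm_apply]
  intro u
  rw [contDiffOn_clm_apply]
  intro v
  rw [← contMDiffOn_iff_contDiffOn]
  have h := ContMDiffOn.inner_bundle (IB := 𝓘(ℝ, E)) (F := E) (n := ∞)
    (E := fun x : M => TangentSpace 𝓘(ℝ, E) x) (b := (extChartAt 𝓘(ℝ, E) x).symm)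
    (v := fun y => mfderiv 𝓘(ℝ, E) 𝓘(ℝ, E) (extChartAt 𝓘(ℝ, E) x).symm y u)
    (w := fun y => mfderiv 𝓘(ℝ, E) 𝓘(ℝ, E) (extChartAt 𝓘(ℝ, E) x).symm y v) (hsec u) (hsec v)
  exact h

end MetricInChart

/-! ### Isometric immersions read in charts. -/

section Gauss

variable {E : Type*} [NormedAddCommGroup E] [NormedSpace ℝ E] [FiniteDimensional ℝ E]
  {M : Type*} [TopologicalSpace M] [ChartedSpace E M] [IsManifold 𝓘(ℝ, E) ∞ M]
  [RiemannianBundle (fun x : M => TangentSpace 𝓘(ℝ, E) x)]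
  {F : Type*} [NormedAddCommGroup F] [NormedSpace ℝ F] [FiniteDimensional ℝ F]
  {N : Type*} [TopologicalSpace N] [ChartedSpace F N] [IsManifold 𝓘(ℝ, F) ∞ N]
  [RiemannianBundle (fun x : N => TangentSpace 𝓘(ℝ, F) x)]
  {f : M → N}

/-- With `modelInner` the vectors live in the fixed model space, so base point and differential can
be rewritten without dependent-type transport. -/
theorem modelInner_mfderiv_congr {h₁ h₂ : E → N} {y : E} (h : h₁ =ᶠ[𝓝 y] h₂) (u v : E) :
    modelInner F (h₁ y) (mfderiv 𝓘(ℝ, E) 𝓘(ℝ, F) h₁ y u) (mfderiv 𝓘(ℝ, E) 𝓘(ℝ, F) h₁ y v) =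
    modelInner F (h₂ y) (mfderiv 𝓘(ℝ, E) 𝓘(ℝ, F) h₂ y u) (mfderiv 𝓘(ℝ, E) 𝓘(ℝ, F) h₂ y v) := by
  rw [h.mfderiv_eq, h.eq_of_nhds]

theorem contDiffAt_writtenInExtChartAt (hf : ContMDiff 𝓘(ℝ, E) 𝓘(ℝ, F) ∞ f) (x : M) :
    ContDiffAt ℝ ∞ (writtenInExtChartAt 𝓘(ℝ, E) 𝓘(ℝ, F) x f) (extChartAt 𝓘(ℝ, E) x x) := by
  have h := (contMDiffAt_iff.1 (hf x)).2
  rwa [modelWithCornersSelf_coe, Set.range_id, contDiffWithinAt_univ] at h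

/-- An isometric immersion, read in charts, pulls back the metric. -/
theorem IsIsometricImmersion.eventually_metricInChart_eq (hf : IsIsometricImmersion E F f) (x : M) :
    ∀ᶠ y in 𝓝 (extChartAt 𝓘(ℝ, E) x x), ∀ u v, metricInChart E x y u v =
      metricInChart F (f x) (writtenInExtChartAt 𝓘(ℝ, E) 𝓘(ℝ, F) x f y)
        (fderiv ℝ (writtenInExtChartAt 𝓘(ℝ, E) 𝓘(ℝ, F) x f) y u)
        (fderiv ℝ (writtenInExtChartAt 𝓘(ℝ, E) 𝓘(ℝ, F) x f) y v) := by
  set W := writtenInExtChartAt 𝓘(ℝ, E) 𝓘(ℝ, F) x f with hW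
  have hcont : ContinuousAt (f ∘ (extChartAt 𝓘(ℝ, E) x).symm) (extChartAt 𝓘(ℝ, E) x x) :=
    hf.smooth.continuous.continuousAt.comp (continuousAt_extChartAt_symm x)
  have hsrc : ∀ᶠ y in 𝓝 (extChartAt 𝓘(ℝ, E) x x),
      f ((extChartAt 𝓘(ℝ, E) x).symm y) ∈ (extChartAt 𝓘(ℝ, F) (f x)).source := by
    apply hcont.eventually
    simpa using extChartAt_source_mem_nhds (I := 𝓘(ℝ, F)) (f x)
  filter_upwards [hsrc.eventually_nhds, extChartAt_target_mem_nhds (I := 𝓘(ℝ, E)) x,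
    (contDiffAt_writtenInExtChartAt hf.smooth x).of_le (m := 1) (by simp) |>.eventually (by simp)]
    with y hy ht hsm u v
  have hWd : MDifferentiableAt 𝓘(ℝ, E) 𝓘(ℝ, F) W y :=
    (hsm.differentiableAt (by simp)).mdifferentiableAt
  have hφ : MDifferentiableAt 𝓘(ℝ, E) 𝓘(ℝ, E) (extChartAt 𝓘(ℝ, E) x).symm y :=
    ((contMDiffOn_extChartAt_symm (I := 𝓘(ℝ, E)) (n := ∞) x).contMDiffAt
      ((isOpen_extChartAt_target x).mem_nhds ht)).mdifferentiableAt (by simp)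
  have hWt : W y ∈ (extChartAt 𝓘(ℝ, F) (f x)).target :=
    (extChartAt 𝓘(ℝ, F) (f x)).map_source hy.self_of_nhds
  have hψ : MDifferentiableAt 𝓘(ℝ, F) 𝓘(ℝ, F) (extChartAt 𝓘(ℝ, F) (f x)).symm (W y) :=
    ((contMDiffOn_extChartAt_symm (I := 𝓘(ℝ, F)) (n := ∞) (f x)).contMDiffAt
      ((isOpen_extChartAt_target (f x)).mem_nhds hWt)).mdifferentiableAt (by simp)
  -- The chain rule on the two sides compares df ∘ dφ⁻¹ with dψ⁻¹ ∘ DW, where φ, ψ are the charts at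
  -- x and f x.
  have heq : f ∘ (extChartAt 𝓘(ℝ, E) x).symm =ᶠ[𝓝 y] (extChartAt 𝓘(ℝ, F) (f x)).symm ∘ W := by
    filter_upwards [hy] with z hz
    exact ((extChartAt 𝓘(ℝ, F) (f x)).left_inv hz).symm
  have hcomp := modelInner_mfderiv_congr (F := F) heq u v
  rw [mfderiv_comp y (hf.smooth.mdifferentiableAt (by simp)) hφ, mfderiv_comp y hψ hWd,
    mfderiv_eq_fderiv] at hcomp
  rw [metricInChart_apply, metricInChart_apply]
  refine Eq.trans ?_ hcomp
  exact (hf.isometric _ _ _).symm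

end Gauss

/-! ### The Gauss formula and the Gauss equation on manifolds. -/

section GaussEquation

variable {E : Type*} [NormedAddCommGroup E] [NormedSpace ℝ E] [FiniteDimensional ℝ E]
  {M : Type*} [TopologicalSpace M] [ChartedSpace E M] [IsManifold 𝓘(ℝ, E) ∞ M]
  [RiemannianBundle (fun x : M => TangentSpace 𝓘(ℝ, E) x)]
  [IsContMDiffRiemannianBundle 𝓘(ℝ, E) ∞ E (fun x : M => TangentSpace 𝓘(ℝ, E) x)]
  {F : Type*} [NormedAddCommGroup F] [NormedSpace ℝ F] [FiniteDimensional ℝ F]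
  {N : Type*} [TopologicalSpace N] [ChartedSpace F N] [IsManifold 𝓘(ℝ, F) ∞ N]
  [RiemannianBundle (fun x : N => TangentSpace 𝓘(ℝ, F) x)]
  [IsContMDiffRiemannianBundle 𝓘(ℝ, F) ∞ F (fun x : N => TangentSpace 𝓘(ℝ, F) x)]
  {f : M → N}

theorem contDiffAt_metricInChart (x : M) :
    ContDiffAt ℝ 2 (metricInChart E x) (extChartAt 𝓘(ℝ, E) x x) :=
  ((contDiffOn_metricInChart x).contDiffAt (extChartAt_target_mem_nhds x)).of_le
    ENat.LEInfty.out

theorem eventually_metricInChart_isInvertible (x : M) :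
    ∀ᶠ y in 𝓝 (extChartAt 𝓘(ℝ, E) x x), (metricInChart E x y).IsInvertible := by
  filter_upwards [extChartAt_target_mem_nhds (I := 𝓘(ℝ, E)) x] with y hy using
    metricInChart_isInvertible x hy

theorem writtenInExtChartAt_self (x : M) :
    writtenInExtChartAt 𝓘(ℝ, E) 𝓘(ℝ, F) x f (extChartAt 𝓘(ℝ, E) x x) =
      extChartAt 𝓘(ℝ, F) (f x) (f x) := by
  rw [writtenInExtChartAt, Function.comp, Function.comp, extChartAt_to_inv]

theorem IsIsometricImmersion.mfderiv_eq (hf : IsIsometricImmersion E F f) (x : M) :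
    mfderiv 𝓘(ℝ, E) 𝓘(ℝ, F) f x =
      fderiv ℝ (writtenInExtChartAt 𝓘(ℝ, E) 𝓘(ℝ, F) x f) (extChartAt 𝓘(ℝ, E) x x) := by
  rw [(hf.smooth.mdifferentiable (by simp) x).mfderiv, modelWithCornersSelf_coe, Set.range_id,
    fderivWithin_univ]

variable (E) in
/-- The covariant derivative `∇_u v` at `x` of vector fields which are constant in the preferred
chart. -/
noncomputable def christoffelAt (x : M) (u v : TangentSpace 𝓘(ℝ, E) x) : TangentSpace 𝓘(ℝ, E) x :=
  christoffel (E := E) (metricInChart E x) (extChartAt 𝓘(ℝ, E) x x) u v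

theorem metricInChart_writtenInExtChartAt (x : M) (a b : F) :
    metricInChart F (f x) (writtenInExtChartAt 𝓘(ℝ, E) 𝓘(ℝ, F) x f (extChartAt 𝓘(ℝ, E) x x)) a b =
      modelInner F (f x) a b := by
  rw [writtenInExtChartAt_self, metricInChart_self]

theorem IsIsometricImmersion.modelInner_coordDerivativeAlong (hf : IsIsometricImmersion E F f)
    (x : M) (u v w : E) :
    modelInner F (f x) (coordDerivativeAlong (metricInChart F (f x))
        (writtenInExtChartAt 𝓘(ℝ, E) 𝓘(ℝ, F) x f) (extChartAt 𝓘(ℝ, E) x x) u v)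
      (fderiv ℝ (writtenInExtChartAt 𝓘(ℝ, E) 𝓘(ℝ, F) x f) (extChartAt 𝓘(ℝ, E) x x) w) =
      modelInner E x (christoffel (metricInChart E x) (extChartAt 𝓘(ℝ, E) x x) u v) w := by
  rw [← metricInChart_writtenInExtChartAt (E := E) x, ← metricInChart_self x,
    metric_christoffel (eventually_metricInChart_isInvertible x).self_of_nhds]
  exact metric_coordDerivativeAlong
    ((contDiffAt_writtenInExtChartAt hf.smooth x).of_le ENat.LEInfty.out)
    (by rw [writtenInExtChartAt_self]
        exact (contDiffAt_metricInChart (f x)).differentiableAt (by norm_num))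
    (.of_forall fun q u v => metricInChart_symm _ q u v)
    (by rw [writtenInExtChartAt_self]
        exact (eventually_metricInChart_isInvertible (f x)).self_of_nhds)
    ((contDiffAt_metricInChart x).differentiableAt (by norm_num))
    (hf.eventually_metricInChart_eq x) u v w

theorem IsIsometricImmersion.inner_ambientDerivative (hf : IsIsometricImmersion E F f) (x : M)
    (u v w : TangentSpace 𝓘(ℝ, E) x) :
    inner ℝ (ambientDerivative E F f x u v) (mfderiv 𝓘(ℝ, E) 𝓘(ℝ, F) f x w) =
      inner ℝ (christoffelAt E x u v) w := by
  rw [hf.mfderiv_eq]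
  exact hf.modelInner_coordDerivativeAlong x u v w

/-- The Gauss formula. -/
theorem IsIsometricImmersion.ambientDerivative_eq (hf : IsIsometricImmersion E F f) (x : M)
    (u v : TangentSpace 𝓘(ℝ, E) x) :
    ambientDerivative E F f x u v = mfderiv 𝓘(ℝ, E) 𝓘(ℝ, F) f x (christoffelAt E x u v)
      + (secondFundamentalForm E F f x u v : TangentSpace 𝓘(ℝ, F) (f x)) := by
  have hmem : ambientDerivative E F f x u v
      - mfderiv 𝓘(ℝ, E) 𝓘(ℝ, F) f x (christoffelAt E x u v) ∈ normalSpace E F f x := by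
    rw [normalSpace, Submodule.mem_orthogonal']
    rintro _ ⟨w, rfl⟩
    change inner ℝ _ (mfderiv 𝓘(ℝ, E) 𝓘(ℝ, F) f x w) = 0
    rw [inner_sub_left, hf.inner_ambientDerivative, hf.isometric, sub_self]
  -- Normal difference and tangential remainder characterize the orthogonal projection.
  rw [← sub_eq_iff_eq_add', secondFundamentalForm]
  symm
  apply Submodule.eq_starProjection_of_mem_orthogonal hmem
  rw [sub_sub_cancel, normalSpace]
  exact Submodule.le_orthogonal_orthogonal _ (LinearMap.mem_range_self _ _)

theorem inner_mfderiv_normal (x : M) (w : TangentSpace 𝓘(ℝ, E) x) (ξ : normalSpace E F f x) :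
    inner ℝ (mfderiv 𝓘(ℝ, E) 𝓘(ℝ, F) f x w) (ξ : TangentSpace 𝓘(ℝ, F) (f x)) = 0 :=
  (Submodule.mem_orthogonal _ _).1 ξ.2 _ (LinearMap.mem_range_self _ _)

theorem IsIsometricImmersion.inner_ambientDerivative_ambientDerivative
    (hf : IsIsometricImmersion E F f) (x : M) (u v w t : TangentSpace 𝓘(ℝ, E) x) :
    inner ℝ (ambientDerivative E F f x u v) (ambientDerivative E F f x w t) =
      inner ℝ (christoffelAt E x u v) (christoffelAt E x w t)
      + inner ℝ (secondFundamentalForm E F f x u v) (secondFundamentalForm E F f x w t) := by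
  rw [hf.ambientDerivative_eq, hf.ambientDerivative_eq, inner_add_left, inner_add_right,
    inner_add_right, hf.isometric, inner_mfderiv_normal,
    real_inner_comm (mfderiv 𝓘(ℝ, E) 𝓘(ℝ, F) f x _), inner_mfderiv_normal, Submodule.coe_inner]
  ring

theorem IsIsometricImmersion.secondFundamentalForm_symm (hf : IsIsometricImmersion E F f) (x : M)
    (u v : TangentSpace 𝓘(ℝ, E) x) :
    secondFundamentalForm E F f x u v = secondFundamentalForm E F f x v u := by
  have h := coordDerivativeAlong_symm (G := metricInChart F (f x))
    (f := writtenInExtChartAt 𝓘(ℝ, E) 𝓘(ℝ, F) x f) (y := extChartAt 𝓘(ℝ, E) x x)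
    ((contDiffAt_writtenInExtChartAt hf.smooth x).of_le ENat.LEInfty.out)
    (by rw [writtenInExtChartAt_self]
        exact (contDiffAt_metricInChart (f x)).differentiableAt (by norm_num))
    (.of_forall fun q u v => metricInChart_symm _ q u v) u v
  exact congrArg (normalSpace E F f x).orthogonalProjectionOnto h

theorem IsIsometricImmersion.modelInner_coordCurvature (hf : IsIsometricImmersion E F f)
    (x : M) (u v w t : E) :
    let W := writtenInExtChartAt 𝓘(ℝ, E) 𝓘(ℝ, F) x f
    let y := extChartAt 𝓘(ℝ, E) x x
    let B := coordDerivativeAlong (metricInChart F (f x)) W y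
    let Γ := christoffel (metricInChart E x) y
    modelInner E x (coordCurvature (E := E) (metricInChart E x) y u v w) t =
      modelInner F (f x) (coordCurvature (E := F) (metricInChart F (f x)) (extChartAt 𝓘(ℝ, F) (f x) (f x))
        (fderiv ℝ W y u) (fderiv ℝ W y v) (fderiv ℝ W y w)) (fderiv ℝ W y t)
      + (modelInner F (f x) (B v w) (B u t) - modelInner E x (Γ v w) (Γ u t))
      - (modelInner F (f x) (B u w) (B v t) - modelInner E x (Γ u w) (Γ v t)) := by
  intro W y B Γ
  rw [← metricInChart_self x, ← metricInChart_self x, ← metricInChart_self x,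
    ← metricInChart_writtenInExtChartAt (E := E) x, ← metricInChart_writtenInExtChartAt (E := E) x,
    ← metricInChart_writtenInExtChartAt (E := E) x, ← writtenInExtChartAt_self (E := E) x]
  exact coord_gauss ((contDiffAt_writtenInExtChartAt hf.smooth x).of_le ENat.LEInfty.out)
    (by rw [writtenInExtChartAt_self]; exact contDiffAt_metricInChart (f x))
    (.of_forall fun q u v => metricInChart_symm _ q u v)
    (by rw [writtenInExtChartAt_self]; exact eventually_metricInChart_isInvertible (f x))
    (contDiffAt_metricInChart x)
    (.of_forall fun q u v => metricInChart_symm _ q u v)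
    (eventually_metricInChart_isInvertible x)
    (hf.eventually_metricInChart_eq x) u v w t

variable (E) in
/-- The tangent space with its Riemannian norm, identified with the model space. -/
noncomputable def tangentEquiv (x : M) : TangentSpace 𝓘(ℝ, E) x ≃L[ℝ] E :=
  (show TangentSpace 𝓘(ℝ, E) x ≃ₗ[ℝ] E from LinearEquiv.refl ℝ E).toContinuousLinearEquiv

variable (E) in
/-- The metric in the preferred chart at `x`, seen as a metric on the tangent space at `x`. -/
noncomputable def metricOnTangentSpace (x : M) : TangentSpace 𝓘(ℝ, E) x →
    TangentSpace 𝓘(ℝ, E) x →L[ℝ] TangentSpace 𝓘(ℝ, E) x →L[ℝ] ℝ :=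
  metricInChart E x

theorem metricOnTangentSpace_eq (x : M) : metricOnTangentSpace E x =
    fun z => (metricInChart E x (tangentEquiv E x z)).bilinearComp
      (tangentEquiv E x : TangentSpace 𝓘(ℝ, E) x →L[ℝ] E)
      (tangentEquiv E x : TangentSpace 𝓘(ℝ, E) x →L[ℝ] E) := by
  funext z
  ext u v
  rfl

/-- `curvatureTensor` differentiates over the tangent space with its Riemannian norm, whereas the
chart computations use the norm of `E`. Making the former explicit lets `map_coordCurvature` pass
between them. -/
theorem curvatureTensor_eq (x : M) (y u v w : TangentSpace 𝓘(ℝ, E) x)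
    (hy : tangentEquiv E x y = extChartAt 𝓘(ℝ, E) x x) :
    curvatureTensor E x u v w = coordCurvature (metricOnTangentSpace E x) y u v w := by
  change y = _ at hy
  rw [curvatureTensor, metricOnTangentSpace, hy]

theorem tangentEquiv_coordCurvature (x : M) (y u v w : TangentSpace 𝓘(ℝ, E) x)
    (hy : tangentEquiv E x y = extChartAt 𝓘(ℝ, E) x x) :
    tangentEquiv E x (coordCurvature (metricOnTangentSpace E x) y u v w) =
      coordCurvature (metricInChart E x) (extChartAt 𝓘(ℝ, E) x x)
        (tangentEquiv E x u) (tangentEquiv E x v) (tangentEquiv E x w) := by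
  have : CompleteSpace E := FiniteDimensional.complete ℝ E
  have : CompleteSpace (TangentSpace 𝓘(ℝ, E) x) := FiniteDimensional.complete ℝ _
  rw [← hy]
  exact map_coordCurvature (G := metricInChart E x) (tangentEquiv E x)
    (hy ▸ contDiffAt_metricInChart x) (.of_forall fun q u v => metricInChart_symm _ q u v)
    (hy ▸ eventually_metricInChart_isInvertible x) (metricOnTangentSpace_eq x) u v w

theorem inner_eq_modelInner (x : M) (u v : TangentSpace 𝓘(ℝ, E) x) :
    inner ℝ u v = modelInner E x (tangentEquiv E x u) (tangentEquiv E x v) := rfl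

theorem inner_curvatureTensor (x : M) (u v w t : TangentSpace 𝓘(ℝ, E) x) :
    inner ℝ (curvatureTensor E x u v w) t = modelInner E x
      (coordCurvature (E := E) (metricInChart E x) (extChartAt 𝓘(ℝ, E) x x)
        (tangentEquiv E x u) (tangentEquiv E x v) (tangentEquiv E x w)) (tangentEquiv E x t) := by
  have hy := (tangentEquiv E x).apply_symm_apply (extChartAt 𝓘(ℝ, E) x x)
  rw [curvatureTensor_eq x _ u v w hy, inner_eq_modelInner, tangentEquiv_coordCurvature x _ u v w hy]

theorem inner_christoffelAt (x : M) (a b p q : TangentSpace 𝓘(ℝ, E) x) :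
    inner ℝ (christoffelAt E x a b) (christoffelAt E x p q) = modelInner E x
        (christoffel (metricInChart E x) (extChartAt 𝓘(ℝ, E) x x) a b)
        (christoffel (metricInChart E x) (extChartAt 𝓘(ℝ, E) x x) p q) := rfl

theorem inner_ambientDerivative_eq (x : M) (a b p q : TangentSpace 𝓘(ℝ, E) x) :
    inner ℝ (ambientDerivative E F f x a b) (ambientDerivative E F f x p q) =
        modelInner F (f x) (coordDerivativeAlong (metricInChart F (f x))
            (writtenInExtChartAt 𝓘(ℝ, E) 𝓘(ℝ, F) x f) (extChartAt 𝓘(ℝ, E) x x) a b)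
          (coordDerivativeAlong (metricInChart F (f x))
            (writtenInExtChartAt 𝓘(ℝ, E) 𝓘(ℝ, F) x f) (extChartAt 𝓘(ℝ, E) x x) p q) := rfl

theorem IsIsometricImmersion.inner_curvatureTensor_mfderiv (hf : IsIsometricImmersion E F f)
    (x : M) (u v w t : TangentSpace 𝓘(ℝ, E) x) :
    inner ℝ (curvatureTensor F (f x) (mfderiv 𝓘(ℝ, E) 𝓘(ℝ, F) f x u)
        (mfderiv 𝓘(ℝ, E) 𝓘(ℝ, F) f x v) (mfderiv 𝓘(ℝ, E) 𝓘(ℝ, F) f x w))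
        (mfderiv 𝓘(ℝ, E) 𝓘(ℝ, F) f x t) =
      let W := writtenInExtChartAt 𝓘(ℝ, E) 𝓘(ℝ, F) x f
      let y := extChartAt 𝓘(ℝ, E) x x
      modelInner F (f x) (coordCurvature (E := F) (metricInChart F (f x)) (extChartAt 𝓘(ℝ, F) (f x) (f x))
        (fderiv ℝ W y u) (fderiv ℝ W y v) (fderiv ℝ W y w)) (fderiv ℝ W y t) := by
  rw [hf.mfderiv_eq]
  exact inner_curvatureTensor (E := F) (f x) _ _ _ _

theorem IsIsometricImmersion.gauss_equation_ambient (hf : IsIsometricImmersion E F f) (x : M)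
    (u v w t : TangentSpace 𝓘(ℝ, E) x) :
    inner ℝ (curvatureTensor E x u v w) t =
      inner ℝ (curvatureTensor F (f x) (mfderiv 𝓘(ℝ, E) 𝓘(ℝ, F) f x u)
        (mfderiv 𝓘(ℝ, E) 𝓘(ℝ, F) f x v) (mfderiv 𝓘(ℝ, E) 𝓘(ℝ, F) f x w))
        (mfderiv 𝓘(ℝ, E) 𝓘(ℝ, F) f x t)
      + (inner ℝ (ambientDerivative E F f x v w) (ambientDerivative E F f x u t)
        - inner ℝ (christoffelAt E x v w) (christoffelAt E x u t))
      - (inner ℝ (ambientDerivative E F f x u w) (ambientDerivative E F f x v t)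
        - inner ℝ (christoffelAt E x u w) (christoffelAt E x v t)) := by
  rw [inner_curvatureTensor, hf.inner_curvatureTensor_mfderiv, inner_christoffelAt,
    inner_christoffelAt, inner_ambientDerivative_eq, inner_ambientDerivative_eq]
  exact hf.modelInner_coordCurvature x u v w t

/-- The Gauss equation. -/
theorem IsIsometricImmersion.gauss_equation (hf : IsIsometricImmersion E F f) (x : M)
    (u v w t : TangentSpace 𝓘(ℝ, E) x) :
    inner ℝ (curvatureTensor E x u v w) t =
      inner ℝ (curvatureTensor F (f x) (mfderiv 𝓘(ℝ, E) 𝓘(ℝ, F) f x u)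
        (mfderiv 𝓘(ℝ, E) 𝓘(ℝ, F) f x v) (mfderiv 𝓘(ℝ, E) 𝓘(ℝ, F) f x w))
        (mfderiv 𝓘(ℝ, E) 𝓘(ℝ, F) f x t)
      + inner ℝ (secondFundamentalForm E F f x v w) (secondFundamentalForm E F f x u t)
      - inner ℝ (secondFundamentalForm E F f x u w) (secondFundamentalForm E F f x v t) := by
  -- The tangential parts of the products are exactly the subtracted Christoffel terms.
  rw [hf.gauss_equation_ambient, hf.inner_ambientDerivative_ambientDerivative x v w u t,
    hf.inner_ambientDerivative_ambientDerivative x u w v t, add_sub_cancel_left,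
    add_sub_cancel_left]

/-- The sectional curvatures of a submanifold of a space form. -/
theorem IsIsometricImmersion.sectionalCurvature_eq (hf : IsIsometricImmersion E F f) {c : ℝ}
    (hN : HasConstantSectionalCurvature F N c) (x : M) {u v : TangentSpace 𝓘(ℝ, E) x}
    (huv : Orthonormal ℝ ![u, v]) :
    sectionalCurvature E x u v = c
      + inner ℝ (secondFundamentalForm E F f x u u) (secondFundamentalForm E F f x v v)
      - ‖secondFundamentalForm E F f x u v‖ ^ 2 := by
  obtain ⟨hu, hv, h⟩ := orthonormal_pair_iff.1 huv
  let df := mfderiv 𝓘(ℝ, E) 𝓘(ℝ, F) f x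
  have hn : ∀ a, ‖df a‖ = ‖a‖ := fun a => by
    rw [norm_eq_sqrt_real_inner, norm_eq_sqrt_real_inner, hf.isometric]
  have h1 : ‖df u‖ = 1 := (hn u).trans hu
  have h2 : ‖df v‖ = 1 := (hn v).trans hv
  have h3 : inner ℝ (df u) (df v) = 0 := (hf.isometric x u v).trans h
  have hc := hN (f x) (df u) (df v) (orthonormal_pair_iff.2 ⟨h1, h2, h3⟩)
  rw [sectionalCurvature, h1, h2, h3] at hc
  rw [sectionalCurvature, hu, hv, h, hf.gauss_equation, hf.secondFundamentalForm_symm x v u,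
    real_inner_self_eq_norm_sq, real_inner_comm (secondFundamentalForm E F f x v v)]
  simp only [one_pow, mul_one, ne_eq, OfNat.ofNat_ne_zero, not_false_eq_true, zero_pow, sub_zero,
    div_one] at hc ⊢
  rw [hc, real_inner_comm]

end GaussEquation

/-! ### Submanifolds of a space form: the inequality and its equality case. -/

section SpaceForm

variable {E : Type*} [NormedAddCommGroup E] [NormedSpace ℝ E] [FiniteDimensional ℝ E]
  {M : Type*} [TopologicalSpace M] [ChartedSpace E M] [IsManifold 𝓘(ℝ, E) ∞ M]
  [RiemannianBundle (fun x : M => TangentSpace 𝓘(ℝ, E) x)]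
  [IsContMDiffRiemannianBundle 𝓘(ℝ, E) ∞ E (fun x : M => TangentSpace 𝓘(ℝ, E) x)]
  {F : Type*} [NormedAddCommGroup F] [NormedSpace ℝ F] [FiniteDimensional ℝ F]
  {N : Type*} [TopologicalSpace N] [ChartedSpace F N] [IsManifold 𝓘(ℝ, F) ∞ N]
  [RiemannianBundle (fun x : N => TangentSpace 𝓘(ℝ, F) x)]
  [IsContMDiffRiemannianBundle 𝓘(ℝ, F) ∞ F (fun x : N => TangentSpace 𝓘(ℝ, F) x)]
  {f : M → N} {c : ℝ} {n : ℕ}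

theorem finrank_tangentSpace (x : M) :
    Module.finrank ℝ (TangentSpace 𝓘(ℝ, E) x) = Module.finrank ℝ E := rfl

variable (E F) in
/-- The second fundamental form as a bilinear map. -/
noncomputable def secondFundamentalFormBilin (f : M → N) (x : M) :
    TangentSpace 𝓘(ℝ, E) x →ₗ[ℝ] TangentSpace 𝓘(ℝ, E) x →ₗ[ℝ] normalSpace E F f x :=
  LinearMap.mk₂ ℝ (secondFundamentalForm E F f x)
    (fun _ _ _ => by simp [secondFundamentalForm]) (fun _ _ _ => by simp [secondFundamentalForm])
    (fun _ _ _ => by simp [secondFundamentalForm]) (fun _ _ _ => by simp [secondFundamentalForm])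

theorem secondFundamentalFormBilin_apply (x : M) (u v : TangentSpace 𝓘(ℝ, E) x) :
    secondFundamentalFormBilin E F f x u v = secondFundamentalForm E F f x u v := rfl

theorem continuous_secondFundamentalForm (x : M) :
    Continuous fun p : TangentSpace 𝓘(ℝ, E) x × TangentSpace 𝓘(ℝ, E) x =>
      secondFundamentalForm E F f x p.1 p.2 := by
  unfold secondFundamentalForm
  fun_prop

theorem norm_meanCurvature_sq {x : M} (e : OrthonormalBasis (Fin n) ℝ (TangentSpace 𝓘(ℝ, E) x))
    (hn : n ≠ 0) : (n : ℝ) ^ 2 * ‖meanCurvature E F f x‖ ^ 2 =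
      ‖∑ i, secondFundamentalForm E F f x (e i) (e i)‖ ^ 2 := by
  have hfin : Module.finrank ℝ E = n := by
    rw [← finrank_tangentSpace x, Module.finrank_eq_card_basis e.toBasis, Fintype.card_fin]
  have h := sum_bilin_orthonormalBasis_eq (secondFundamentalFormBilin E F f x)
    (stdOrthonormalBasis ℝ (TangentSpace 𝓘(ℝ, E) x)) e
  simp only [secondFundamentalFormBilin_apply] at h
  rw [meanCurvature, h, hfin, norm_smul, mul_pow, ← mul_assoc, norm_inv, Real.norm_natCast,
    ← mul_pow, mul_inv_cancel₀ (by exact_mod_cast hn), one_pow, one_mul]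

/-- The Gauss equation is summed in the standard basis defining τ; both resulting traces are basis
independent and so can be moved to `e`. -/
theorem IsIsometricImmersion.scalarCurvature_eq (hf : IsIsometricImmersion E F f)
    (hN : HasConstantSectionalCurvature F N c) {x : M}
    (e : OrthonormalBasis (Fin n) ℝ (TangentSpace 𝓘(ℝ, E) x)) :
    scalarCurvature E x = (((n : ℝ) ^ 2 - n) * c
      + ‖∑ i, secondFundamentalForm E F f x (e i) (e i)‖ ^ 2
      - ∑ i, ∑ j, ‖secondFundamentalForm E F f x (e i) (e j)‖ ^ 2) / 2 := by
  have hfin : Module.finrank ℝ (TangentSpace 𝓘(ℝ, E) x) = n := by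
    rw [Module.finrank_eq_card_basis e.toBasis, Fintype.card_fin]
  have h1 := sum_bilin_orthonormalBasis_eq (secondFundamentalFormBilin E F f x)
    (stdOrthonormalBasis ℝ (TangentSpace 𝓘(ℝ, E) x)) e
  have h2 := sum_sum_norm_sq_orthonormalBasis_eq (secondFundamentalFormBilin E F f x)
    (stdOrthonormalBasis ℝ (TangentSpace 𝓘(ℝ, E) x)) e
  simp only [secondFundamentalFormBilin_apply] at h1 h2
  rw [← h1, ← h2, ← hfin, ← sum_sum_lt_gauss c (fun i j => secondFundamentalForm E F f x
    (stdOrthonormalBasis ℝ (TangentSpace 𝓘(ℝ, E) x) i)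
    (stdOrthonormalBasis ℝ (TangentSpace 𝓘(ℝ, E) x) j))
    (fun i j => hf.secondFundamentalForm_symm x _ _), scalarCurvature]
  refine Finset.sum_congr rfl fun i _ => Finset.sum_congr rfl fun j _ => ?_
  split_ifs with hij
  · apply hf.sectionalCurvature_eq hN
    have ho := (stdOrthonormalBasis ℝ (TangentSpace 𝓘(ℝ, E) x)).orthonormal
    exact orthonormal_pair_iff.2 ⟨ho.1 i, ho.1 j, ho.2 hij.ne⟩
  · rfl

/-- The sectional curvature attains its maximum on the planes of a tangent space. -/
theorem IsIsometricImmersion.isGreatest_maxSectionalCurvature (hf : IsIsometricImmersion E F f)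
    (hN : HasConstantSectionalCurvature F N c) (hE : 2 ≤ Module.finrank ℝ E) (x : M) :
    IsGreatest (sectionalCurvatures E x) (maxSectionalCurvature E x) := by
  -- This expression is continuous on all pairs and agrees with the sectional curvature on
  -- orthonormal ones.
  let K : TangentSpace 𝓘(ℝ, E) x × TangentSpace 𝓘(ℝ, E) x → ℝ := fun p => c
    + inner ℝ (secondFundamentalForm E F f x p.1 p.1) (secondFundamentalForm E F f x p.2 p.2)
    - ‖secondFundamentalForm E F f x p.1 p.2‖ ^ 2
  have hK : Continuous K := by
    have h := continuous_secondFundamentalForm (E := E) (F := F) (f := f) x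
    exact (continuous_const.add ((h.comp (continuous_fst.prodMk continuous_fst)).inner
      (h.comp (continuous_snd.prodMk continuous_snd)))).sub (h.norm.pow 2)
  have himage : sectionalCurvatures E x =
      K '' {p : TangentSpace 𝓘(ℝ, E) x × TangentSpace 𝓘(ℝ, E) x | Orthonormal ℝ ![p.1, p.2]} := by
    ext k
    constructor
    · rintro ⟨u, v, huv, rfl⟩
      exact ⟨(u, v), huv, (hf.sectionalCurvature_eq hN x huv).symm⟩
    · rintro ⟨⟨u, v⟩, huv, rfl⟩
      exact ⟨u, v, huv, (hf.sectionalCurvature_eq hN x huv).symm⟩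
  have hcomp : IsCompact (sectionalCurvatures E x) := by
    rw [himage]
    exact isCompact_orthonormal_pairs.image hK
  have hne : (sectionalCurvatures E x).Nonempty := by
    have ho := (stdOrthonormalBasis ℝ (TangentSpace 𝓘(ℝ, E) x)).orthonormal
    let i : Fin (Module.finrank ℝ (TangentSpace 𝓘(ℝ, E) x)) := ⟨0, by
      rw [finrank_tangentSpace]; omega⟩
    let j : Fin (Module.finrank ℝ (TangentSpace 𝓘(ℝ, E) x)) := ⟨1, by
      rw [finrank_tangentSpace]; omega⟩
    exact ⟨_, _, _, orthonormal_pair_iff.2 ⟨ho.1 i, ho.1 j, ho.2 (by simp [i, j])⟩, rfl⟩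
  obtain ⟨k, hk⟩ := hcomp.exists_isGreatest hne
  rw [maxSectionalCurvature, hk.csSup_eq]
  exact hk

/-- The defect in the inequality for `τ + k(e_i ∧ e_j)`. -/
theorem IsIsometricImmersion.scalarCurvature_add_sectionalCurvature
    (hf : IsIsometricImmersion E F f) (hN : HasConstantSectionalCurvature F N c) {x : M}
    (e : OrthonormalBasis (Fin n) ℝ (TangentSpace 𝓘(ℝ, E) x)) {i j : Fin n} (hij : i ≠ j) :
    scalarCurvature E x + sectionalCurvature E x (e i) (e j) =
      ((n : ℝ) ^ 2 - n + 2) * c / 2 + (n : ℝ) ^ 2 * ‖meanCurvature E F f x‖ ^ 2 / 2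
      - (∑ k, ∑ l, ‖secondFundamentalForm E F f x (e k) (e l)‖ ^ 2
          - 2 * inner ℝ (secondFundamentalForm E F f x (e i) (e i))
            (secondFundamentalForm E F f x (e j) (e j))
          + 2 * ‖secondFundamentalForm E F f x (e i) (e j)‖ ^ 2) / 2 := by
  have hn : n ≠ 0 := i.pos.ne'
  have ho := e.orthonormal
  rw [norm_meanCurvature_sq e hn, hf.scalarCurvature_eq hN e, hf.sectionalCurvature_eq hN x
    (orthonormal_pair_iff.2 ⟨ho.1 i, ho.1 j, ho.2 hij⟩)]
  ring

/-- The defect identity is used in a basis whose first two vectors span a plane of maximal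
curvature. -/
theorem IsIsometricImmersion.deltaPrime_le (hf : IsIsometricImmersion E F f)
    (hN : HasConstantSectionalCurvature F N c) (hE : Module.finrank ℝ E = n) (hn : 2 ≤ n) (x : M) :
    deltaPrime E x ≤
      ((n : ℝ) ^ 2 - n + 2) * c / 2 + (n : ℝ) ^ 2 * ‖meanCurvature E F f x‖ ^ 2 / 2 := by
  obtain ⟨u, v, huv, hk⟩ := (hf.isGreatest_maxSectionalCurvature hN (hE ▸ hn) x).1
  have hij : (⟨0, by omega⟩ : Fin n) ≠ ⟨1, by omega⟩ := by simp
  obtain ⟨e, rfl, rfl⟩ := exists_orthonormalBasis_extending_pair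
    (by rw [finrank_tangentSpace, hE, Fintype.card_fin]) hij huv
  rw [deltaPrime, hk, hf.scalarCurvature_add_sectionalCurvature hN e hij]
  have := sum_norm_sq_sub_nonneg (fun k l => secondFundamentalForm E F f x (e k) (e l)) hij
  linarith

/-- The equality case, in terms of the second fundamental form. -/
theorem IsIsometricImmersion.deltaPrime_eq_iff (hf : IsIsometricImmersion E F f)
    (hN : HasConstantSectionalCurvature F N c) (hE : Module.finrank ℝ E = n) (x : M)
    {i j : Fin n} (hij : i ≠ j) :
    deltaPrime E x =
      ((n : ℝ) ^ 2 - n + 2) * c / 2 + (n : ℝ) ^ 2 * ‖meanCurvature E F f x‖ ^ 2 / 2 ↔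
    ∃ e : OrthonormalBasis (Fin n) ℝ (TangentSpace 𝓘(ℝ, E) x),
      secondFundamentalForm E F f x (e i) (e i) = secondFundamentalForm E F f x (e j) (e j) ∧
      ∀ k l, (k ≠ l ∨ (k ≠ i ∧ k ≠ j)) → secondFundamentalForm E F f x (e k) (e l) = 0 := by
  have hn : 2 ≤ n := by
    have := i.isLt
    have := j.isLt
    have : (i : ℕ) ≠ j := fun h => hij (Fin.ext h)
    omega
  have hmax := hf.isGreatest_maxSectionalCurvature hN (hE ▸ hn) x
  constructor
  · intro h
    obtain ⟨u, v, huv, hk⟩ := hmax.1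
    obtain ⟨e, rfl, rfl⟩ := exists_orthonormalBasis_extending_pair
      (by rw [finrank_tangentSpace, hE, Fintype.card_fin]) hij huv
    refine ⟨e, (sum_norm_sq_sub_eq_zero_iff
      (fun k l => secondFundamentalForm E F f x (e k) (e l)) hij).1 ?_⟩
    rw [deltaPrime, hk, hf.scalarCurvature_add_sectionalCurvature hN e hij] at h
    linarith
  -- The plane e_i∧e_j is not assumed maximal: its curvature is at most max k, which gives the
  -- reverse inequality.
  · rintro ⟨e, he⟩
    refine le_antisymm (hf.deltaPrime_le hN hE hn x) ?_
    have h0 := (sum_norm_sq_sub_eq_zero_iff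
      (fun k l => secondFundamentalForm E F f x (e k) (e l)) hij).2 he
    have h1 := hf.scalarCurvature_add_sectionalCurvature hN e hij
    have ho := e.orthonormal
    have h2 : sectionalCurvature E x (e i) (e j) ≤ maxSectionalCurvature E x :=
      hmax.2 ⟨_, _, orthonormal_pair_iff.2 ⟨ho.1 i, ho.1 j, ho.2 hij⟩, rfl⟩
    rw [deltaPrime]
    linarith

/-- An isometric differential is injective. The two dimensions then add up to that of `F`, so the
natural-number subtraction is not truncated. -/
theorem IsIsometricImmersion.finrank_normalSpace (hf : IsIsometricImmersion E F f) (x : M) :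
    Module.finrank ℝ (normalSpace E F f x) = Module.finrank ℝ F - Module.finrank ℝ E := by
  have hinj : Function.Injective (mfderiv 𝓘(ℝ, E) 𝓘(ℝ, F) f x).toLinearMap := by
    rw [injective_iff_map_eq_zero]
    intro u hu
    have h := hf.isometric x u u
    have hu' : mfderiv 𝓘(ℝ, E) 𝓘(ℝ, F) f x u = 0 := hu
    rw [hu', inner_zero_left] at h
    exact inner_self_eq_zero.1 h.symm
  have h := Submodule.finrank_add_finrank_orthogonal
    (LinearMap.range (mfderiv 𝓘(ℝ, E) 𝓘(ℝ, F) f x).toLinearMap)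
  rw [LinearMap.finrank_range_of_inj hinj, finrank_tangentSpace, finrank_tangentSpace] at h
  rw [normalSpace]
  omega

theorem toMatrix_weingarten {κ : Type*} [Fintype κ] [DecidableEq κ] {x : M}
    (e : OrthonormalBasis κ ℝ (TangentSpace 𝓘(ℝ, E) x)) (ξ : normalSpace E F f x) (k l : κ) :
    LinearMap.toMatrix e.toBasis e.toBasis (weingarten E F f x ξ) k l =
      inner ℝ (secondFundamentalForm E F f x (e l) (e k)) ξ := by
  rw [LinearMap.toMatrix_apply, e.coe_toBasis, e.coe_toBasis_repr_apply, e.repr_apply_apply,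
    real_inner_comm, inner_weingarten]

/-- A normal vector is determined by its products with the `ξ r`, so conditions on all the matrices
become conditions on h. The right-hand side does not involve `ξ`. -/
theorem weingarten_diagonal_iff {κ : Type*} [Fintype κ] {x : M} {i j : Fin n}
    (hi : (i : ℕ) = 0) (hj : (j : ℕ) = 1)
    (e : OrthonormalBasis (Fin n) ℝ (TangentSpace 𝓘(ℝ, E) x))
    (ξ : OrthonormalBasis κ ℝ (normalSpace E F f x)) :
    (∀ r, ∃ a : ℝ, LinearMap.toMatrix e.toBasis e.toBasis (weingarten E F f x (ξ r)) =
      Matrix.diagonal (fun i : Fin n => if (i : ℕ) < 2 then a else 0)) ↔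
    secondFundamentalForm E F f x (e i) (e i) = secondFundamentalForm E F f x (e j) (e j) ∧
      ∀ k l, (k ≠ l ∨ (k ≠ i ∧ k ≠ j)) → secondFundamentalForm E F f x (e k) (e l) = 0 := by
  have hlt : ∀ k : Fin n, (k : ℕ) < 2 ↔ k = i ∨ k = j := by
    intro k
    rw [Fin.ext_iff, Fin.ext_iff, hi, hj]
    omega
  constructor
  · intro h
    have hent : ∀ r, ∃ a : ℝ, ∀ k l, inner ℝ (secondFundamentalForm E F f x (e l) (e k)) (ξ r) =
        Matrix.diagonal (fun i : Fin n => if (i : ℕ) < 2 then a else 0) k l := by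
      intro r
      obtain ⟨a, ha⟩ := h r
      exact ⟨a, fun k l => by rw [← ha, toMatrix_weingarten]⟩
    constructor
    · apply InnerProductSpace.ext_inner_right_basis ξ.toBasis
      intro r
      obtain ⟨a, ha⟩ := hent r
      rw [ξ.coe_toBasis, ha, ha]
      simp [hi, hj]
    · intro k l hkl
      apply InnerProductSpace.ext_inner_right_basis ξ.toBasis
      intro r
      obtain ⟨a, ha⟩ := hent r
      rw [ξ.coe_toBasis, ha, inner_zero_left, Matrix.diagonal_apply]
      split_ifs with h1 h2
      · subst h1
        rw [hlt] at h2
        tauto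
      · rfl
      · rfl
  · rintro ⟨h1, h2⟩ r
    refine ⟨inner ℝ (secondFundamentalForm E F f x (e i) (e i)) (ξ r), ?_⟩
    ext k l
    rw [toMatrix_weingarten, Matrix.diagonal_apply]
    split_ifs with h3 h4
    · subst h3
      rcases (hlt k).1 h4 with rfl | rfl
      · rfl
      · rw [h1]
    · subst h3
      rw [hlt, not_or] at h4
      rw [h2 k k (.inr h4), inner_zero_left]
    · rw [h2 l k (.inl (Ne.symm h3)), inner_zero_left]

end SpaceForm

end RiemannianGeometry

open RiemannianGeometry Bundle in
theorem theorem3p2 {n m : ℕ} (hn : 3 ≤ n) (c : ℝ)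
    {M : Type*} [TopologicalSpace M] [ChartedSpace (EuclideanSpace ℝ (Fin n)) M]
    [IsManifold (𝓡 n) ∞ M]
    [RiemannianBundle (fun x : M => TangentSpace (𝓡 n) x)]
    [IsContMDiffRiemannianBundle (𝓡 n) ∞ (EuclideanSpace ℝ (Fin n))
      (fun x : M => TangentSpace (𝓡 n) x)]
    {N : Type*} [TopologicalSpace N] [ChartedSpace (EuclideanSpace ℝ (Fin m)) N]
    [IsManifold (𝓡 m) ∞ N]
    [RiemannianBundle (fun y : N => TangentSpace (𝓡 m) y)]
    [IsContMDiffRiemannianBundle (𝓡 m) ∞ (EuclideanSpace ℝ (Fin m))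
      (fun y : N => TangentSpace (𝓡 m) y)]
    (hN : HasConstantSectionalCurvature (EuclideanSpace ℝ (Fin m)) N c)
    (f : M → N)
    (hf : IsIsometricImmersion (EuclideanSpace ℝ (Fin n)) (EuclideanSpace ℝ (Fin m)) f)
    (x : M) :
    IsGreatest (sectionalCurvatures (EuclideanSpace ℝ (Fin n)) x)
      (maxSectionalCurvature (EuclideanSpace ℝ (Fin n)) x) ∧
    deltaPrime (EuclideanSpace ℝ (Fin n)) x ≤ ((n : ℝ) ^ 2 - n + 2) * c / 2 +
      (n : ℝ) ^ 2 * ‖meanCurvature (EuclideanSpace ℝ (Fin n)) (EuclideanSpace ℝ (Fin m)) f x‖ ^ 2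
        / 2 ∧
    (deltaPrime (EuclideanSpace ℝ (Fin n)) x = ((n : ℝ) ^ 2 - n + 2) * c / 2 +
      (n : ℝ) ^ 2 * ‖meanCurvature (EuclideanSpace ℝ (Fin n)) (EuclideanSpace ℝ (Fin m)) f x‖ ^ 2
        / 2 ↔
      ∃ (e : OrthonormalBasis (Fin n) ℝ (TangentSpace (𝓡 n) x))
        (ξ : OrthonormalBasis (Fin (m - n)) ℝ
          (normalSpace (EuclideanSpace ℝ (Fin n)) (EuclideanSpace ℝ (Fin m)) f x)),
        ∀ r : Fin (m - n), ∃ a : ℝ,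
          LinearMap.toMatrix e.toBasis e.toBasis
            (weingarten (EuclideanSpace ℝ (Fin n)) (EuclideanSpace ℝ (Fin m)) f x (ξ r)) =
          Matrix.diagonal (fun i : Fin n => if (i : ℕ) < 2 then a else 0)) := by
  have hE : Module.finrank ℝ (EuclideanSpace ℝ (Fin n)) = n := by simp
  have hij : (⟨0, by omega⟩ : Fin n) ≠ ⟨1, by omega⟩ := by simp
  refine ⟨hf.isGreatest_maxSectionalCurvature hN (by omega) x,
    hf.deltaPrime_le hN hE (by omega) x, ?_⟩
  rw [hf.deltaPrime_eq_iff hN hE x hij]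
  refine exists_congr fun e => ⟨fun h => ?_, fun ⟨ξ, hξ⟩ => (weingarten_diagonal_iff rfl rfl e ξ).1 hξ⟩
  have hcard : Module.finrank ℝ
      (normalSpace (EuclideanSpace ℝ (Fin n)) (EuclideanSpace ℝ (Fin m)) f x) = m - n := by
    rw [hf.finrank_normalSpace, hE, finrank_euclideanSpace_fin]
  -- Any orthonormal normal basis serves here, since the condition on h is independent of it.
  let ξ := (stdOrthonormalBasis ℝ
    (normalSpace (EuclideanSpace ℝ (Fin n)) (EuclideanSpace ℝ (Fin m)) f x)).reindex
      (finCongr hcard)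
  exact ⟨ξ, (weingarten_diagonal_iff rfl rfl e ξ).2 h⟩
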